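/- Conventions. Let $A$ be a unital C*-algebra. A sub-C*-algebra $B\subseteq A$ is a *Cartan subalgebra* if $B$ is maximal abelian in $A$, if the set of normalizers $N_A(B)=\{n\in A : nBn^*\subseteq B,\ n^*Bn\subseteq B\}$ generates $A$ as a C*-algebra, and if there is a faithful conditional expectation $P:A\to B$ of $A$ onto $B$. It is a *C*-diagonal* if, moreover, every pure state of $B$ extends uniquely to a state of $A$. A *homogeneous C*-algebra* is here a finite direct sum $A=\bigoplus_i A^i$, where $A^i$ is the C*-algebra of continuous sections of a locally trivial C*-bundle with fibre $M_{r^i}(\mathbb C)$, $r^i\ge 1$, over a compact connected Hausdorff space $Z^i$. (For instance $A^i=p^i(C(Z^i)\otimes M_{N^i})p^i$ for a projection $p^i\in C(Z^i)\otimes M_{N^i}$ of rank $r^i$.) Put $Z=\coprod_i Z^i$ and $r(x)=r^i$ for $x\in Z^i$, and let $\mathrm{ev}_x:A\to M_{r(x)}(\mathbb C)$ be evaluation at $x\in Z$, where the fibre at $x$ is identified with $M_{r(x)}(\mathbb C)$. A unital $*$-homomorphism $\varphi:A\to A'$ between homogeneous C*-algebras, with associated spaces $Z$ and $Z'$, is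 *maximally homogeneous* if for every $y\in Z'$ the representation $\mathrm{ev}_y\circ\varphi$ is unitarily equivalent to a finite direct sum $\bigoplus_{\mu}\mathrm{ev}_{x_\mu}$ with pairwise distinct points $x_\mu\in Z$. Theorem. Let $A_1\xrightarrow{\varphi_1}A_2\xrightarrow{\varphi_2}A_3\to\cdots$ be a sequence of homogeneous C*-algebras with unital, injective, maximally homogeneous $*$-homomorphisms $\varphi_n:A_n\to A_{n+1}$. If $A_1$ has a C*-diagonal, then the inductive limit $A=\varinjlim_n(A_n,\varphi_n)$ has a C*-diagonal. -/

import Mathlib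

open Filter Topology Bundle

universe u v w

noncomputable section

/-! ### Cartan subalgebras and C*-diagonals of unital C*-algebras -/

section Diagonal

open scoped ComplexOrder

/-- A state of a unital *-algebra: a positive linear functional that takes the value `1` at `1`. -/
def IsState {A : Type u} [Ring A] [StarRing A] [Algebra ℂ A] (f : A →ₗ[ℂ] ℂ) : Prop :=
  (∀ a : A, 0 ≤ f (star a * a)) ∧ f 1 = 1

/-- A pure state: an extreme point of the convex set of all states. -/
def IsPureState {A : Type u} [Ring A] [StarRing A] [Algebra ℂ A] (f : A →ₗ[ℂ] ℂ) : Prop :=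
  f ∈ Set.extremePoints ℝ {g : A →ₗ[ℂ] ℂ | IsState g}

/-- The set `N_A(B)` of normalizers of `B` in `A`. -/
def normalizers {A : Type u} [CStarAlgebra A] (B : StarSubalgebra ℂ A) : Set A :=
  {n | ∀ b ∈ B, n * b * star n ∈ B ∧ star n * b * n ∈ B}

/-- A conditional expectation of `A` onto `B`: a positive, `B`-bimodular linear projection of `A`
onto `B`.  (Positive elements of a C*-algebra are those of the form `c* c`.) -/
structure IsConditionalExpectation {A : Type u} [CStarAlgebra A] (B : StarSubalgebra ℂ A)
    (P : A →ₗ[ℂ] A) : Prop where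
  mem : ∀ a, P a ∈ B
  map_of_mem : ∀ b ∈ B, P b = b
  map_mul_left : ∀ b ∈ B, ∀ a, P (b * a) = b * P a
  map_mul_right : ∀ b ∈ B, ∀ a, P (a * b) = P a * b
  positive : ∀ a, ∃ c ∈ B, P (star a * a) = star c * c

/-- Cartan subalgebras of a unital C*-algebra.  A maximal abelian *-subalgebra of a unital
C*-algebra contains the unit, so it is no restriction to consider unital subalgebras only. -/
structure IsCartanSubalgebra {A : Type u} [CStarAlgebra A] (B : StarSubalgebra ℂ A) : Prop where
  isClosed : IsClosed (B : Set A)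
  maximal_abelian :
    Maximal (fun C : StarSubalgebra ℂ A => ∀ x ∈ C, ∀ y ∈ C, x * y = y * x) B
  regular : (StarAlgebra.adjoin ℂ (normalizers B)).topologicalClosure = ⊤
  exists_faithful_expectation : ∃ P : A →ₗ[ℂ] A, IsConditionalExpectation B P ∧
    ∀ a, P (star a * a) = 0 → a = 0

/-- A C*-diagonal: a Cartan subalgebra with the unique extension property, i.e. every pure state
of `B` extends uniquely to a state of `A`. -/
structure IsCStarDiagonal {A : Type u} [CStarAlgebra A] (B : StarSubalgebra ℂ A) : Prop
    extends IsCartanSubalgebra B where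
  unique_extension : ∀ f : B →ₗ[ℂ] ℂ, IsPureState f →
    ∃! g : A →ₗ[ℂ] ℂ, IsState g ∧ ∀ b : B, g (b : A) = f b

end Diagonal

/-! ### Homogeneous C*-algebras -/

/-- A locally trivial C*-bundle with fibre `M_r`, `r ≥ 1`, over a compact connected Hausdorff space
`Z`: a fibre bundle whose fibres are C*-algebras and whose local trivializations are fibrewise
*-isomorphisms onto `M_r`.  (The topology of the fibres is the norm topology.) -/
structure MatrixBundle where
  Z : Type u
  [topZ : TopologicalSpace Z]
  [compactZ : CompactSpace Z]
  [t2Z : T2Space Z]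
  [connectedZ : ConnectedSpace Z]
  r : ℕ
  r_pos : 0 < r
  Fib : Z → Type v
  [cstar : ∀ x, CStarAlgebra (Fib x)]
  [topTotal : TopologicalSpace (TotalSpace (Matrix (Fin r) (Fin r) ℂ) Fib)]
  [fiberBundle : FiberBundle (Matrix (Fin r) (Fin r) ℂ) Fib]
  triv_star : ∀ e ∈ FiberBundle.trivializationAtlas (Matrix (Fin r) (Fin r) ℂ) Fib,
    ∀ x ∈ e.baseSet, ∃ α : Fib x ≃⋆ₐ[ℂ] Matrix (Fin r) (Fin r) ℂ, ∀ v, (e ⟨x, v⟩).2 = α v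

namespace MatrixBundle

attribute [instance] topZ compactZ t2Z connectedZ cstar topTotal fiberBundle

/-- The fibre `M_r`. -/
abbrev Mat (E : MatrixBundle.{u, v}) : Type := Matrix (Fin E.r) (Fin E.r) ℂ

/-- The identification of the fibre at `x` with `M_r` by the preferred trivialization at `x`. -/
def coord (E : MatrixBundle.{u, v}) (x : E.Z) (a : E.Fib x) : E.Mat :=
  (trivializationAt E.Mat E.Fib x ⟨x, a⟩).2

/-- Continuity of a section of the bundle. -/
def IsContSection (E : MatrixBundle.{u, v}) (s : ∀ x, E.Fib x) : Prop :=
  Continuous fun x => TotalSpace.mk' E.Mat x (s x)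

/-- The preferred trivialization around `x₀`, on the fibre over `x`. -/
def loc (E : MatrixBundle.{u, v}) (x₀ x : E.Z) (a : E.Fib x) : E.Mat :=
  (trivializationAt E.Mat E.Fib x₀ ⟨x, a⟩).2

theorem eventually_loc (E : MatrixBundle.{u, v}) (x₀ : E.Z) :
    ∀ᶠ x in 𝓝 x₀, ∃ α : E.Fib x ≃⋆ₐ[ℂ] E.Mat, ∀ v, E.loc x₀ x v = α v := by
  filter_upwards [(trivializationAt E.Mat E.Fib x₀).open_baseSet.mem_nhds
    (FiberBundle.mem_baseSet_trivializationAt' x₀)] with x hx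
  exact E.triv_star _ (FiberBundle.trivialization_mem_atlas' x₀) x hx

theorem isContSection_iff (E : MatrixBundle.{u, v}) (s : ∀ x, E.Fib x) :
    E.IsContSection s ↔ ∀ x₀, ContinuousAt (fun x => E.loc x₀ x (s x)) x₀ := by
  unfold IsContSection
  rw [continuous_iff_continuousAt]
  refine forall_congr' fun x₀ => ?_
  rw [FiberBundle.continuousAt_totalSpace]
  exact ⟨fun h => h.2, fun h => ⟨continuousAt_id, h⟩⟩

/-- The *-algebra of continuous sections. -/
def sectionSubalgebra (E : MatrixBundle.{u, v}) : StarSubalgebra ℂ (∀ x, E.Fib x) where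
  carrier := {s | E.IsContSection s}
  mul_mem' {s t} hs ht := by
    rw [Set.mem_ofPred_eq, isContSection_iff] at *
    intro x₀
    refine ((hs x₀).mul (ht x₀)).congr ?_
    filter_upwards [E.eventually_loc x₀] with x ⟨α, hα⟩
    simp [hα]
  add_mem' {s t} hs ht := by
    rw [Set.mem_ofPred_eq, isContSection_iff] at *
    intro x₀
    refine ((hs x₀).add (ht x₀)).congr ?_
    filter_upwards [E.eventually_loc x₀] with x ⟨α, hα⟩
    simp [hα]
  algebraMap_mem' c := by
    rw [Set.mem_ofPred_eq, isContSection_iff]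
    intro x₀
    refine (continuousAt_const (y := algebraMap ℂ E.Mat c)).congr ?_
    filter_upwards [E.eventually_loc x₀] with x ⟨α, hα⟩
    rw [hα, Pi.algebraMap_apply]
    simp [Algebra.algebraMap_eq_smul_one]
  star_mem' {s} hs := by
    rw [Set.mem_ofPred_eq, isContSection_iff] at *
    intro x₀
    refine ((hs x₀).star).congr ?_
    filter_upwards [E.eventually_loc x₀] with x ⟨α, hα⟩
    simp [hα, map_star]

/-- The C*-algebra of continuous sections of `E`, with pointwise operations and the norm
`‖a‖ = sup_x ‖a(x)‖`. -/
def Sections (E : MatrixBundle.{u, v}) : Type (max u v) := E.sectionSubalgebra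

namespace Sections

variable {E : MatrixBundle.{u, v}}

instance : CoeFun E.Sections (fun _ => ∀ x, E.Fib x) := ⟨fun a => a.1⟩

instance : Ring E.Sections := inferInstanceAs (Ring E.sectionSubalgebra)
instance : StarRing E.Sections := inferInstanceAs (StarRing E.sectionSubalgebra)
instance : Algebra ℂ E.Sections := inferInstanceAs (Algebra ℂ E.sectionSubalgebra)
instance : StarModule ℂ E.Sections := inferInstanceAs (StarModule ℂ E.sectionSubalgebra)

theorem ext {a b : E.Sections} (h : ∀ x, a x = b x) : a = b := Subtype.ext (funext h)

theorem add_apply (a b : E.Sections) (x : E.Z) : (a + b) x = a x + b x := rfl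
theorem sub_apply (a b : E.Sections) (x : E.Z) : (a - b) x = a x - b x := rfl
theorem neg_apply (a : E.Sections) (x : E.Z) : (-a) x = -a x := rfl
theorem zero_apply (x : E.Z) : (0 : E.Sections) x = 0 := rfl
theorem mul_apply (a b : E.Sections) (x : E.Z) : (a * b) x = a x * b x := rfl
theorem star_apply (a : E.Sections) (x : E.Z) : (star a) x = star (a x) := rfl
theorem smul_apply (c : ℂ) (a : E.Sections) (x : E.Z) : (c • a) x = c • a x := rfl

open scoped Matrix.Norms.L2Operator in
theorem eventually_norm (E : MatrixBundle.{u, v}) (x₀ : E.Z) :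
    ∀ᶠ x in 𝓝 x₀, ∀ v w, ‖E.loc x₀ x v - E.loc x₀ x w‖ = ‖v - w‖ ∧ ‖E.loc x₀ x v‖ = ‖v‖ := by
  filter_upwards [E.eventually_loc x₀] with x ⟨α, hα⟩ v w
  rw [hα, hα, ← map_sub]
  exact ⟨NonUnitalStarAlgHom.norm_map α α.injective _, NonUnitalStarAlgHom.norm_map α α.injective _⟩

open scoped Matrix.Norms.L2Operator in
theorem continuous_norm_apply (a : E.Sections) : Continuous fun x => ‖a x‖ := by
  rw [continuous_iff_continuousAt]
  intro x₀
  refine (((E.isContSection_iff _).1 a.2 x₀).norm).congr ?_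
  filter_upwards [eventually_norm E x₀] with x hx
  exact (hx (a x) 0).2

theorem bddAbove (a : E.Sections) : BddAbove (Set.range fun x => ‖a x‖) :=
  (isCompact_range a.continuous_norm_apply).bddAbove

instance : Norm E.Sections := ⟨fun a => ⨆ x, ‖a x‖⟩

theorem norm_def (a : E.Sections) : ‖a‖ = ⨆ x, ‖a x‖ := rfl

theorem norm_apply_le (a : E.Sections) (x : E.Z) : ‖a x‖ ≤ ‖a‖ := le_ciSup a.bddAbove x

theorem norm_le {a : E.Sections} {C : ℝ} (h : ∀ x, ‖a x‖ ≤ C) : ‖a‖ ≤ C := ciSup_le h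

theorem norm_nonneg' (a : E.Sections) : 0 ≤ ‖a‖ := Real.iSup_nonneg fun _ => norm_nonneg _

instance : NormedAddCommGroup E.Sections :=
  AddGroupNorm.toNormedAddCommGroup
    { toFun := fun a => ‖a‖
      map_zero' := le_antisymm (norm_le fun x => by simp [zero_apply]) (norm_nonneg' _)
      add_le' := fun a b => norm_le fun x =>
        (norm_add_le (a x) (b x)).trans (add_le_add (norm_apply_le a x) (norm_apply_le b x))
      neg' := fun a => by simp only [norm_def, neg_apply, norm_neg]
      eq_zero_of_map_eq_zero' := fun a h => ext fun x => norm_le_zero_iff.1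
        ((norm_apply_le a x).trans h.le) }

instance : NormedRing E.Sections where
  dist_eq := dist_eq_norm_neg_add
  norm_mul_le a b := norm_le fun x => (norm_mul_le (a x) (b x)).trans
    (mul_le_mul (norm_apply_le a x) (norm_apply_le b x) (norm_nonneg _) (norm_nonneg' _))

instance : NormedAlgebra ℂ E.Sections where
  norm_smul_le c a := norm_le fun x => by
    rw [smul_apply, norm_smul]
    exact mul_le_mul_of_nonneg_left (norm_apply_le a x) (norm_nonneg _)

instance : CStarRing E.Sections where
  norm_mul_self_le a := by
    have h : ‖a‖ ≤ √‖star a * a‖ := norm_le fun x => by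
      refine Real.le_sqrt_of_sq_le ?_
      rw [sq, ← CStarRing.norm_star_mul_self]
      exact norm_apply_le (star a * a) x
    calc ‖a‖ * ‖a‖ ≤ √‖star a * a‖ * √‖star a * a‖ :=
          mul_le_mul h h (norm_nonneg' _) (Real.sqrt_nonneg _)
      _ = ‖star a * a‖ := Real.mul_self_sqrt (norm_nonneg' _)

open scoped Matrix.Norms.L2Operator in
instance : CompleteSpace E.Sections := by
  refine Metric.complete_of_cauchySeq_tendsto fun a ha => ?_
  have hx : ∀ x, CauchySeq fun n => a n x := fun x => by
    rw [Metric.cauchySeq_iff] at ha ⊢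
    intro ε hε
    obtain ⟨N, hN⟩ := ha ε hε
    refine ⟨N, fun m hm n hn => lt_of_le_of_lt ?_ (hN m hm n hn)⟩
    rw [dist_eq_norm, dist_eq_norm]
    exact norm_apply_le (a m - a n) x
  choose s hs using fun x => cauchySeq_tendsto_of_complete (hx x)
  have hunif : ∀ ε > 0, ∃ N, ∀ n ≥ N, ∀ x, ‖a n x - s x‖ ≤ ε := fun ε hε => by
    obtain ⟨N, hN⟩ := Metric.cauchySeq_iff.1 ha ε hε
    refine ⟨N, fun n hn x => ?_⟩
    refine le_of_tendsto ((tendsto_const_nhds.sub (hs x)).norm) ?_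
    filter_upwards [eventually_ge_atTop N] with m hm
    have := (hN n hn m hm).le
    rw [dist_eq_norm] at this
    exact (norm_apply_le (a n - a m) x).trans this
  have hcont : E.IsContSection s := by
    rw [isContSection_iff]
    intro x₀
    rw [Metric.continuousAt_iff']
    intro ε hε
    obtain ⟨N, hN⟩ := hunif (ε / 4) (by positivity)
    have h1 := Metric.continuousAt_iff'.1 ((E.isContSection_iff _).1 (a N).2 x₀) (ε / 4)
      (by positivity)
    have h0 := (eventually_norm E x₀).self_of_nhds
    filter_upwards [h1, eventually_norm E x₀] with x h2 h3
    have e1 := (h3 (a N x) (s x)).1.trans_le (hN N le_rfl x)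
    have e2 := (h0 (a N x₀) (s x₀)).1.trans_le (hN N le_rfl x₀)
    rw [← dist_eq_norm] at e1 e2
    rw [dist_comm] at e1
    linarith [dist_triangle4 (E.loc x₀ x (s x)) (E.loc x₀ x (a N x)) (E.loc x₀ x₀ (a N x₀))
      (E.loc x₀ x₀ (s x₀))]
  let t : E.Sections := ⟨s, hcont⟩
  refine ⟨t, Metric.tendsto_atTop.2 fun ε hε => ?_⟩
  obtain ⟨N, hN⟩ := hunif (ε / 2) (by positivity)
  refine ⟨N, fun n hn => ?_⟩
  rw [dist_eq_norm]
  exact lt_of_le_of_lt (norm_le (a := a n - t) fun x => hN n hn x) (by linarith)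

instance : CStarAlgebra E.Sections where

end Sections

end MatrixBundle

/-- The homogeneous C*-algebra `⨁ i, A^i`, a finite direct sum of algebras of continuous sections
of locally trivial matrix bundles, with the pointwise operations and the maximum norm. -/
abbrev HomogeneousAlgebra {ι : Type w} (E : ι → MatrixBundle.{u, v}) : Type (max u v w) :=
  ∀ i, (E i).Sections

namespace HomogeneousAlgebra

variable {ι : Type w} {κ : Type w}

/-- The disjoint union of the base spaces. -/
abbrev Base (E : ι → MatrixBundle.{u, v}) : Type (max u w) := Σ i, (E i).Z

/-- The rank `r(x)` of the fibre over `x`. -/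
abbrev rank (E : ι → MatrixBundle.{u, v}) (x : Base E) : ℕ := (E x.1).r

/-- The irreducible representation `ev_x`, evaluation at the point `x`, with values in
`M_{r(x)}`. -/
def ev (E : ι → MatrixBundle.{u, v}) (x : Base E) (a : HomogeneousAlgebra E) :
    Matrix (Fin (rank E x)) (Fin (rank E x)) ℂ :=
  (E x.1).coord x.2 (a x.1 x.2)

/-- A unital *-homomorphism `φ` is maximally homogeneous if for every point `y` the representation
`ev_y ∘ φ` is unitarily equivalent to a direct sum of evaluations `ev_{x_μ}` at pairwise distinct
points `x_μ`. -/
def IsMaximallyHomogeneous {E : ι → MatrixBundle.{u, v}} {F : κ → MatrixBundle.{u, v}}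
    [Fintype ι] [Fintype κ] (φ : HomogeneousAlgebra E →⋆ₐ[ℂ] HomogeneousAlgebra F) : Prop :=
  ∀ y : Base F, ∃ (m : ℕ) (x : Fin m → Base E)
    (U : Matrix (Fin (rank F y)) (Σ μ : Fin m, Fin (rank E (x μ))) ℂ),
    Function.Injective x ∧ U * U.conjTranspose = 1 ∧ U.conjTranspose * U = 1 ∧
    ∀ a, ev F y (φ a) = U * Matrix.blockDiagonal' (fun μ => ev E (x μ) a) * U.conjTranspose

end HomogeneousAlgebra

/-! ### Inductive limits of C*-algebras -/

section Limit

variable {A : ℕ → Type u} [∀ n, CStarAlgebra (A n)]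

/-- The composed connecting map `A_n → A_{n+k}`. -/
def connectingMap (φ : ∀ n, A n →⋆ₐ[ℂ] A (n + 1)) (n : ℕ) : ∀ k, A n → A (n + k)
  | 0 => fun a => a
  | k + 1 => fun a => φ (n + k) (connectingMap φ n k a)

/-- `L`, with the canonical maps `ψ_n : A_n → L`, is the inductive limit of the sequence
`A_0 → A_1 → ⋯` in the category of unital C*-algebras, i.e. the completion of the algebraic
inductive limit for the seminorm `‖[a]‖ = lim_k ‖φ_{n+k,n}(a)‖`, `a ∈ A_n`. -/
structure IsInductiveLimit (φ : ∀ n, A n →⋆ₐ[ℂ] A (n + 1)) (L : Type v) [CStarAlgebra L]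
    (ψ : ∀ n, A n →⋆ₐ[ℂ] L) : Prop where
  compatible : ∀ n a, ψ (n + 1) (φ n a) = ψ n a
  dense : Dense (⋃ n, Set.range (ψ n))
  norm_eq : ∀ n a, Tendsto (fun k => ‖connectingMap φ n k a‖) atTop (𝓝 ‖ψ n a‖)

end Limit

end

/-! The diagonal of the limit is built stage by stage: given `B n`, let `B (n + 1)` be the commutant
of `φ n '' B n`. The invariant is `IsFieldDiagonal`: `B n` equals its own commutant, and in every
fibre its image contains the diagonal matrices of some orthonormal basis. A C*-diagonal of the first
algebra has this property, because unique extension of pure states forces distinct common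
eigenvectors in a fibre to give distinct characters. The property passes to the next stage because
the points `x_μ` are distinct: central functions separate them, so the fibre of `φ(B)` contains all
diagonal matrices of the combined basis. Hence an element of the commutant agrees, in each single
fibre, with some `φ(b)`, `b ∈ B`. The commutant is therefore abelian, and `φ` carries normalizers to
normalizers.

The properties of a diagonal are carried through the limit by an expectation `P` whose kernel is
controlled by the products `b * a * c` with `b * c = 0` (`IsDiagonalExpectation`). At a finite
stage, spectral cutoffs give local minimal projections in `B`, and a partition of unity turns them
into a finite frame `e i j` with `P a = ∑ e i j * a * e i j`. Such an expectation is determined by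
`B`, so the expectations of successive stages are compatible and extend to a contraction `Q` on the
limit.

All clauses but faithfulness pass to the limit by density. For faithfulness, the set of `a` with `Q
(a* a) = 0` is a two-sided ideal, since `Q` commutes with conjugation by normalizers and these
generate. It meets the image of every stage trivially, so each stage is isometric modulo the ideal
on self-adjoint elements, and density makes the ideal zero. Finally, a faithful diagonal expectation
makes `B` a C*-diagonal: a pure state of `B` is a character, so it kills `b` or `c` whenever `b * c
= 0`, and by Cauchy–Schwarz every extension kills `b * a * c`. -/

noncomputable section

/-! ### Degenerate Cauchy–Schwarz for positive maps -/

section Positive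

/-- Dividing by `s` and letting `s → ±∞`, closedness of the positive cone gives `0 ≤ w` and `0 ≤
-w`. -/
theorem eq_zero_of_forall_nonneg_add_smul {V : Type*} [CStarAlgebra V] [PartialOrder V]
    [StarOrderedRing V] {c w : V} (h : ∀ s : ℝ, 0 ≤ c + s • w) : w = 0 := by
  have key : ∀ w : V, (∀ s : ℝ, 0 ≤ c + s • w) → 0 ≤ w := fun w h => by
    have ht : Tendsto (fun s : ℝ => s⁻¹ • c + w) atTop (𝓝 ((0 : ℝ) • c + w)) :=
      (tendsto_inv_atTop_zero.smul_const c).add_const w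
    rw [zero_smul, zero_add] at ht
    refine CStarAlgebra.isClosed_nonneg.mem_of_tendsto ht ?_
    filter_upwards [eventually_gt_atTop 0] with s hs
    have := smul_nonneg (inv_nonneg.2 hs.le) (h s)
    rwa [smul_add, smul_smul, inv_mul_cancel₀ hs.ne', one_smul] at this
  refine le_antisymm (neg_nonneg.1 (key (-w) fun s => ?_)) (key w h)
  simpa using h (-s)

variable {A V : Type*} [Ring A] [StarRing A] [Algebra ℂ A] [StarModule ℂ A] [CStarAlgebra V]
  [PartialOrder V] [StarOrderedRing V]

/-- Since `F (x* x) = 0`, the positive element `F ((y* + s u x)* (y* + s u x))` is affine in the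
real number `s`, so its linear coefficient vanishes. With values in a C*-algebra this serves both
states and expectations. -/
theorem positive_mul_eq_zero (F : A →ₗ[ℂ] V) (hF : ∀ a, 0 ≤ F (star a * a)) {x : A}
    (hx : F (star x * x) = 0) (y : A) : F (y * x) = 0 ∧ F (star x * star y) = 0 := by
  have key : ∀ u : ℂ, u • F (y * x) + star u • F (star x * star y) = 0 := fun u => by
    refine eq_zero_of_forall_nonneg_add_smul (c := F (y * star y)) fun s => ?_
    have := hF (star y + ((s : ℂ) * u) • x)
    simp only [star_add, star_star, star_smul, add_mul, mul_add, map_add, smul_mul_assoc,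
      mul_smul_comm, map_smul, hx, smul_zero, add_zero, star_mul'] at this
    convert this using 1
    simp only [smul_add, mul_smul]
    simp only [← Complex.coe_smul, smul_smul, Complex.star_def, Complex.conj_ofReal]
    abel
  -- The phases `1` and `I` separate the two cross terms.
  have h1 := key 1
  have h2 := key Complex.I
  simp only [one_smul, star_one, Complex.star_def, Complex.conj_I, neg_smul, ← smul_neg,
    ← smul_add] at h1 h2
  have h3 := (smul_eq_zero.1 h2).resolve_left Complex.I_ne_zero
  rw [← sub_eq_add_neg, sub_eq_zero] at h3
  rw [← h3, ← two_smul ℂ] at h1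
  have h4 := (smul_eq_zero.1 h1).resolve_left two_ne_zero
  exact ⟨h4, h3 ▸ h4⟩

end Positive

/-! ### Diagonal expectations, pure states and unique extension -/

section Diagonal

open scoped ComplexOrder

/-- The elements of `B` together with the products `b * a * c` with `b, c ∈ B` and `b * c = 0`. -/
def decomposable {A : Type u} [CStarAlgebra A] (B : StarSubalgebra ℂ A) : Set A :=
  B ∪ {z | ∃ b ∈ B, ∃ a, ∃ c ∈ B, b * c = 0 ∧ z = b * a * c}

/-- A regular closed abelian subalgebra with a conditional expectation whose kernel is generated
by the products `b * a * c` with `b, c ∈ B` and `b * c = 0`. -/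
structure IsDiagonalExpectation {A : Type u} [CStarAlgebra A] (B : StarSubalgebra ℂ A)
    (P : A →ₗ[ℂ] A) : Prop where
  isClosed : IsClosed (B : Set A)
  comm : ∀ x ∈ B, ∀ y ∈ B, x * y = y * x
  mem : ∀ a, P a ∈ B
  map_of_mem : ∀ b ∈ B, P b = b
  map_mul_left : ∀ b ∈ B, ∀ a, P (b * a) = b * P a
  map_mul_right : ∀ b ∈ B, ∀ a, P (a * b) = P a * b
  positive : ∀ a, ∃ c, P (star a * a) = star c * c
  dense : (Submodule.span ℂ (decomposable B)).topologicalClosure = ⊤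
  regular : (StarAlgebra.adjoin ℂ (normalizers B)).topologicalClosure = ⊤

/-- A diagonal expectation that is faithful. -/
structure IsDiagonalPair {A : Type u} [CStarAlgebra A] (B : StarSubalgebra ℂ A)
    (P : A →ₗ[ℂ] A) : Prop extends IsDiagonalExpectation B P where
  faithful : ∀ a, P (star a * a) = 0 → a = 0

theorem exists_sqrt_mem {A : Type u} [CStarAlgebra A] {B : StarSubalgebra ℂ A}
    (hB : IsClosed (B : Set A)) {a : A} (ha : a ∈ B) [PartialOrder A] [StarOrderedRing A]
    (h0 : 0 ≤ a) : ∃ c ∈ B, star c * c = a := by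
  refine ⟨CFC.sqrt a, ?_, ?_⟩
  · rw [CFC.sqrt_eq_real_sqrt a, cfcₙ_eq_cfc]
    exact cfc_mem (hs := hB) _ ha
  · rw [(CFC.sqrt_nonneg a).isSelfAdjoint.star_eq, CFC.sqrt_mul_sqrt_self a]

theorem continuous_of_positive {A V : Type*} [CStarAlgebra A] [CStarAlgebra V] [PartialOrder V]
    [StarOrderedRing V] (F : A →ₗ[ℂ] V) (hF : ∀ a, 0 ≤ F (star a * a)) : Continuous F := by
  let _ := CStarAlgebra.spectralOrder A
  let _ := CStarAlgebra.spectralOrderedRing A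
  have h0 : ∀ a b : A, a ≤ b → F a ≤ F b := fun a b hab => by
    obtain ⟨c, hc⟩ := CStarAlgebra.nonneg_iff_eq_star_mul_self.1 (sub_nonneg.2 hab)
    rw [← sub_nonneg, ← map_sub, hc]
    exact hF c
  let G : A →ₚ[ℂ] V := { F with monotone' := h0 }
  exact map_continuous G

theorem IsState.continuous {A : Type u} [CStarAlgebra A] {g : A →ₗ[ℂ] ℂ} (hg : IsState g) :
    Continuous g := continuous_of_positive g hg.1

/-- If neither weight is zero, `f` is a convex combination of the states `f (b* b ·) / f (b* b)` and
`f (c* c ·) / f (c* c)`, and extremality makes both equal to `f`. A zero weight is handled by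
Cauchy–Schwarz. -/
theorem IsPureState.map_mul_of_add_eq_one {B : Type*} [Ring B] [StarRing B] [Algebra ℂ B]
    [StarModule ℂ B] (hcomm : ∀ x y : B, x * y = y * x) {f : B →ₗ[ℂ] ℂ} (hf : IsPureState f)
    (b c : B) (hbc : star b * b + star c * c = 1) (a : B) :
    f (star b * b * a) = f (star b * b) * f a := by
  obtain ⟨⟨hpos, hone⟩, hext⟩ := hf
  have ht := hpos b
  have hs := hpos c
  have hts : f (star b * b) + f (star c * c) = 1 := by rw [← map_add, hbc, hone]
  have hzero : ∀ b a : B, f (star b * b) = 0 → f (star b * b * a) = 0 := fun b a h0 => by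
    rw [hcomm, ← mul_assoc]
    exact (positive_mul_eq_zero f hpos h0 _).1
  rcases eq_or_ne (f (star b * b)) 0 with h0 | h0
  · rw [h0, zero_mul, hzero b a h0]
  rcases eq_or_ne (f (star c * c)) 0 with h1 | h1
  · have h2 : f (star b * b) = 1 := by rw [← hts, h1, add_zero]
    rw [h2, one_mul]
    have h3 := hzero c a h1
    rw [← eq_sub_iff_add_eq'] at hbc
    rw [hbc, sub_mul, one_mul, map_sub] at h3
    exact (sub_eq_zero.1 h3).symm
  let g : B → B →ₗ[ℂ] ℂ := fun b => (f (star b * b))⁻¹ • f ∘ₗ LinearMap.mulLeft ℂ (star b * b)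
  have hg : ∀ b, f (star b * b) ≠ 0 → IsState (g b) := fun b hb => by
    refine ⟨fun a => ?_, by simp [g, hb]⟩
    have h3 : star b * b * (star a * a) = star (b * a) * (b * a) := by
      rw [← mul_assoc, hcomm (star b * b) (star a)]
      simp only [star_mul, mul_assoc]
    have := mul_nonneg (inv_nonneg.2 (hpos b)) (hpos (b * a))
    rw [← h3] at this
    simpa [g, mul_assoc] using this
  have hreal : ∀ z : ℂ, 0 ≤ z → z ≠ 0 → 0 < z.re ∧ z = (z.re : ℂ) := fun z hz hz0 => by
    have hz' : z = (z.re : ℂ) := Complex.ext rfl (Complex.nonneg_iff.1 hz).2.symm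
    refine ⟨lt_of_le_of_ne (Complex.nonneg_iff.1 hz).1 fun h => hz0 ?_, hz'⟩
    rw [hz', ← h, Complex.ofReal_zero]
  obtain ⟨t0, ht⟩ := hreal _ ht h0
  obtain ⟨s0, hs⟩ := hreal _ hs h1
  have hmem : f ∈ openSegment ℝ (g b) (g c) := by
    refine ⟨_, _, t0, s0, ?_, ?_⟩
    · rw [← Complex.add_re, hts, Complex.one_re]
    · refine LinearMap.ext fun x => ?_
      simp only [LinearMap.add_apply, LinearMap.smul_apply, g, ← Complex.coe_smul, ← ht, ← hs,
        LinearMap.comp_apply, LinearMap.mulLeft_apply, smul_eq_mul]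
      rw [mul_inv_cancel_left₀ h0, mul_inv_cancel_left₀ h1, ← map_add, ← add_mul, hbc, one_mul]
  have := LinearMap.congr_fun (hext (hg b h0) (hg c h1) hmem) a
  simp only [g, LinearMap.smul_apply, LinearMap.comp_apply, LinearMap.mulLeft_apply,
    smul_eq_mul] at this
  rw [← this, mul_inv_cancel_left₀ h0]

/-- For a contraction `b` the square root of `1 - b* b` lies in `B` and supplies the complementary
weight. Scaling and polarization then reach every `x`. -/
theorem IsPureState.map_mul {A : Type u} [CStarAlgebra A] {B : StarSubalgebra ℂ A}
    (hB : IsClosed (B : Set A)) (hc : ∀ x ∈ B, ∀ y ∈ B, x * y = y * x) {f : B →ₗ[ℂ] ℂ}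
    (hf : IsPureState f) (x a : B) : f (x * a) = f x * f a := by
  let _ := CStarAlgebra.spectralOrder A
  let _ := CStarAlgebra.spectralOrderedRing A
  have h1 : ∀ b : B, ‖b‖ ≤ 1 → f (star b * b * a) = f (star b * b) * f a := fun b hb => by
    obtain ⟨c, hc', hcc⟩ : ∃ c ∈ B, star c * c = 1 - star (b : A) * b := by
      refine exists_sqrt_mem hB (sub_mem (one_mem B) (mul_mem (star_mem b.2) b.2)) ?_
      rw [sub_nonneg, ← CStarAlgebra.norm_le_one_iff_of_nonneg _ (star_mul_self_nonneg _),
        CStarRing.norm_star_mul_self]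
      have : ‖(b : A)‖ ≤ 1 := hb
      nlinarith [norm_nonneg (b : A)]
    refine hf.map_mul_of_add_eq_one (fun x y => Subtype.ext (hc x x.2 y y.2)) b ⟨c, hc'⟩
      (Subtype.ext ?_) a
    simp [hcc]
  have h2 : ∀ b : B, f (star b * b * a) = f (star b * b) * f a := fun b => by
    have hr : (0 : ℝ) < ‖b‖ + 1 := by positivity
    have hr' : ((‖b‖ + 1 : ℝ) : ℂ) ≠ 0 := Complex.ofReal_ne_zero.2 hr.ne'
    obtain ⟨b', hb'⟩ : ∃ b', b' = ((‖b‖ + 1 : ℝ) : ℂ)⁻¹ • b := ⟨_, rfl⟩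
    have hb : b = ((‖b‖ + 1 : ℝ) : ℂ) • b' := by rw [hb', smul_inv_smul₀ hr']
    have hn : ‖b'‖ ≤ 1 := by
      rw [hb', norm_smul, norm_inv, Complex.norm_real, Real.norm_of_nonneg hr.le,
        inv_mul_le_iff₀ hr]
      linarith
    have := h1 b' hn
    rw [hb]
    simp only [star_smul, smul_mul_assoc, mul_smul_comm, map_smul, this, smul_eq_mul]
    ring
  -- Polarization against the unit: the terms in `x* x`, `x*` and `1` cancel over the fourth roots
  -- of unity.
  have h3 : (4 : ℂ) • x = ∑ k : Fin 4, Complex.I ^ (k : ℕ) •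
      (star (x + Complex.I ^ (k : ℕ) • 1) * (x + Complex.I ^ (k : ℕ) • 1)) := by
    simp only [Fin.sum_univ_four, star_add, star_smul, star_one, add_mul, mul_add, mul_one,
      one_mul, smul_mul_assoc, mul_smul_comm, smul_add, smul_smul]
    simp [pow_succ]
    module
  have h4 : f ((4 : ℂ) • x * a) = f ((4 : ℂ) • x) * f a := by
    rw [h3]
    simp only [Finset.sum_mul, map_sum, smul_mul_assoc, map_smul, h2, smul_eq_mul]
    exact Finset.sum_congr rfl fun _ _ => (mul_assoc _ _ _).symm
  rw [smul_mul_assoc, map_smul, map_smul, smul_eq_mul, smul_eq_mul, mul_assoc] at h4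
  exact mul_left_cancel₀ four_ne_zero h4

/-- The character `f` vanishes on `(b - f b)* (b - f b)`, hence so does each state in a convex
decomposition of `f`, and Cauchy–Schwarz gives it the value `f b` at `b`. -/
theorem isPureState_of_map_mul {B : Type*} [Ring B] [StarRing B] [Algebra ℂ B]
    [StarModule ℂ B] {f : B →ₗ[ℂ] ℂ} (hf : IsState f) (hmul : ∀ x y, f (x * y) = f x * f y) :
    IsPureState f := by
  refine ⟨hf, fun g hg h hh ⟨t, s, ht, hs, hts, hgh⟩ => LinearMap.ext fun b => ?_⟩
  have h0 : f (b - f b • 1) = 0 := by simp [hf.2]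
  have h1 : f (star (b - f b • 1) * (b - f b • 1)) = 0 := by rw [hmul, h0, mul_zero]
  have h2 : g (star (b - f b • 1) * (b - f b • 1)) = 0 := by
    have h1' := LinearMap.congr_fun hgh (star (b - f b • 1) * (b - f b • 1))
    rw [h1, LinearMap.add_apply, LinearMap.smul_apply, LinearMap.smul_apply] at h1'
    exact (smul_eq_zero.1 ((add_eq_zero_iff_of_nonneg (smul_nonneg ht.le (hg.1 _))
      (smul_nonneg hs.le (hh.1 _))).1 h1').1).resolve_left ht.ne'
  have h3 := (positive_mul_eq_zero g hg.1 h2 1).1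
  rw [one_mul, map_sub, map_smul, hg.2, smul_eq_mul, mul_one, sub_eq_zero] at h3
  exact h3

namespace IsDiagonalExpectation

variable {A : Type u} [CStarAlgebra A] {B : StarSubalgebra ℂ A} {P : A →ₗ[ℂ] A}

/-- The uniqueness principle behind the compatibility of expectations, their equivariance under
normalizers and the unique extension of states. -/
theorem linearMap_eq (hP : IsDiagonalExpectation B P) {V : Type*} [AddCommGroup V] [Module ℂ V]
    [TopologicalSpace V] [T2Space V] {F G : A →ₗ[ℂ] V} (hF : Continuous F) (hG : Continuous G)
    (hB : ∀ b ∈ B, F b = G b)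
    (h : ∀ b ∈ B, ∀ a, ∀ c ∈ B, b * c = 0 → F (b * a * c) = G (b * a * c)) : F = G := by
  have h1 : Submodule.span ℂ (decomposable B) ≤ LinearMap.eqLocus F G := by
    rw [Submodule.span_le]
    rintro x (hx | ⟨b, hb, a, c, hc, hbc, rfl⟩)
    exacts [hB x hx, h b hb a c hc hbc]
  have h2 : Dense (Submodule.span ℂ (decomposable B) : Set A) := by
    rw [Submodule.dense_iff_topologicalClosure_eq_top, hP.dense]
  exact DFunLike.coe_injective (hF.ext_on h2 hG fun x hx => h1 hx)

theorem map_mul_mul (hP : IsDiagonalExpectation B P) {b c : A} (hb : b ∈ B) (hc : c ∈ B)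
    (hbc : b * c = 0) (a : A) : P (b * a * c) = 0 := by
  rw [hP.map_mul_right c hc, hP.map_mul_left b hb, mul_assoc, hP.comm _ (hP.mem a) c hc,
    ← mul_assoc, hbc, zero_mul]

theorem nonneg (hP : IsDiagonalExpectation B P) [PartialOrder A] [StarOrderedRing A] (a : A) :
    0 ≤ P (star a * a) := by
  obtain ⟨c, hc⟩ := hP.positive a
  exact hc ▸ star_mul_self_nonneg c

theorem continuous (hP : IsDiagonalExpectation B P) : Continuous P := by
  let _ := CStarAlgebra.spectralOrder A
  let _ := CStarAlgebra.spectralOrderedRing A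
  exact continuous_of_positive P hP.nonneg

theorem map_mul_eq_zero (hP : IsDiagonalExpectation B P) {x : A} (hx : P (star x * x) = 0) (y : A) :
    P (y * x) = 0 := by
  let _ := CStarAlgebra.spectralOrder A
  let _ := CStarAlgebra.spectralOrderedRing A
  exact (positive_mul_eq_zero P hP.nonneg hx y).1

/-- Positivity makes `P ((1 + u a)* (1 + u a)) - 1 - P ((u a)* (u a))` self-adjoint. Taking `u = 1`
and `u = I` isolates `P (a*)`. -/
theorem map_star (hP : IsDiagonalExpectation B P) (a : A) : P (star a) = star (P a) := by
  have h : ∀ u : ℂ, u • P a + star u • P (star a) =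
      star u • star (P a) + u • star (P (star a)) := fun u => by
    obtain ⟨c, hc⟩ := hP.positive (1 + u • a)
    obtain ⟨d, hd⟩ := hP.positive (u • a)
    have h1 : P (star (1 + u • a) * (1 + u • a)) - 1 - P (star (u • a) * (u • a)) =
        u • P a + star u • P (star a) := by
      simp only [star_add, star_smul, star_one, add_mul, mul_add, mul_one, one_mul, map_add,
        map_smul, hP.map_of_mem 1 (one_mem B)]
      abel
    have h2 : star (u • P a + star u • P (star a)) = u • P a + star u • P (star a) := by
      rw [← h1, hc, hd]
      simp
    rw [← h2]
    simp
  have h1 := h 1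
  have h2 := h Complex.I
  simp only [one_smul, star_one, Complex.star_def, Complex.conj_I] at h1 h2
  have h3 : P (star a) - P a = star (P a) - star (P (star a)) := by
    have := congrArg (fun x => Complex.I • x) h2
    simp only [smul_add, smul_smul, Complex.I_mul_I, neg_neg, one_smul, neg_smul, smul_neg] at this
    rw [sub_eq_add_neg, add_comm, this, sub_eq_add_neg]
  have h4 : (2 : ℂ) • P (star a) = (2 : ℂ) • star (P a) := by
    rw [two_smul, two_smul]
    calc P (star a) + P (star a) = (P (star a) - P a) + (P a + P (star a)) := by abel
      _ = star (P a) + star (P a) := by rw [h3, h1]; abel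
  exact smul_right_injective A two_ne_zero h4

/-- Expanding `0 ≤ P ((a - P a)* (a - P a))` gives the Schwarz inequality `(P a)* (P a) ≤ P (a* a) ≤
‖a‖²`. -/
theorem norm_map_le (hP : IsDiagonalExpectation B P) (a : A) : ‖P a‖ ≤ ‖a‖ := by
  let _ := CStarAlgebra.spectralOrder A
  let _ := CStarAlgebra.spectralOrderedRing A
  have h1 : star (P a) * P a ≤ P (star a * a) := by
    have := hP.nonneg (a - P a)
    have e : P (star (a - P a) * (a - P a)) = P (star a * a) - star (P a) * P a := by
      rw [star_sub, sub_mul, mul_sub, mul_sub, map_sub, map_sub, map_sub,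
        hP.map_mul_right _ (hP.mem a), hP.map_mul_left _ (star_mem (hP.mem a)),
        hP.map_mul_left _ (star_mem (hP.mem a)), hP.map_of_mem _ (hP.mem a), hP.map_star]
      abel
    rwa [e, sub_nonneg] at this
  have h2 : P (star a * a) ≤ algebraMap ℝ A (‖a‖ * ‖a‖) := by
    have h3 : star a * a ≤ algebraMap ℝ A (‖a‖ * ‖a‖) := by
      rw [← CStarRing.norm_star_mul_self]
      exact (IsSelfAdjoint.star_mul_self a).le_algebraMap_norm_self
    obtain ⟨c, hc⟩ := CStarAlgebra.nonneg_iff_eq_star_mul_self.1 (sub_nonneg.2 h3)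
    have h4 := hP.nonneg c
    have h5 : algebraMap ℝ A (‖a‖ * ‖a‖) = algebraMap ℂ A ((‖a‖ * ‖a‖ : ℝ) : ℂ) := rfl
    rwa [← hc, map_sub, h5, hP.map_of_mem _ (algebraMap_mem B _), sub_nonneg, ← h5] at h4
  nontriviality A
  have h3 := CStarAlgebra.norm_le_norm_of_nonneg_of_le (star_mul_self_nonneg (P a)) (h1.trans h2)
  rw [CStarRing.norm_star_mul_self, norm_algebraMap',
    Real.norm_of_nonneg (by positivity)] at h3
  nlinarith [norm_nonneg (P a), norm_nonneg a]

end IsDiagonalExpectation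

namespace IsDiagonalPair

variable {A : Type u} [CStarAlgebra A] {B : StarSubalgebra ℂ A} {P : A →ₗ[ℂ] A}

/-- Put `x = a - P a`, which commutes with `B` and has `P x = 0`. Then `y ↦ P (y x)` kills `B`, and
it kills `b * y * c` because `c` moves past `x`. So `P (x* x) = 0`, and faithfulness gives `x = 0`.
-/
theorem mem_of_commute (hP : IsDiagonalPair B P) {a : A} (ha : ∀ b ∈ B, b * a = a * b) :
    a ∈ B := by
  have h0 : P (a - P a) = 0 := by rw [map_sub, hP.map_of_mem _ (hP.mem a), sub_self]
  have hcomm : ∀ b ∈ B, b * (a - P a) = (a - P a) * b := fun b hb => by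
    rw [mul_sub, sub_mul, ha b hb, hP.comm b hb _ (hP.mem a)]
  have h1 : P ∘ₗ LinearMap.mulRight ℂ (a - P a) = 0 := by
    refine hP.linearMap_eq (hP.continuous.comp (continuous_id.mul continuous_const))
      continuous_const (fun b hb => ?_) fun b hb x c hc hbc => ?_
    · simp only [LinearMap.comp_apply, LinearMap.mulRight_apply, LinearMap.zero_apply]
      rw [hP.map_mul_left b hb, h0, mul_zero]
    · simp only [LinearMap.comp_apply, LinearMap.mulRight_apply, LinearMap.zero_apply]
      rw [mul_assoc (b * x), hcomm c hc, ← mul_assoc, mul_assoc b, hP.map_mul_mul hb hc hbc]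
  have h2 := hP.faithful _ (LinearMap.congr_fun h1 (star (a - P a)))
  rw [sub_eq_zero.1 h2]
  exact hP.mem a

theorem isCStarDiagonal (hP : IsDiagonalPair B P) : IsCStarDiagonal B where
  isClosed := hP.isClosed
  maximal_abelian := ⟨hP.comm, fun C hC hBC a ha =>
    hP.mem_of_commute fun b hb => hC b (hBC hb) a ha⟩
  regular := hP.regular
  exists_faithful_expectation := by
    refine ⟨P, ⟨hP.mem, hP.map_of_mem, hP.map_mul_left, hP.map_mul_right, fun a => ?_⟩,
      hP.faithful⟩
    let _ := CStarAlgebra.spectralOrder A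
    let _ := CStarAlgebra.spectralOrderedRing A
    obtain ⟨c, hc, h⟩ := exists_sqrt_mem hP.isClosed (hP.mem _) (hP.nonneg a)
    exact ⟨c, hc, h.symm⟩
  unique_extension f hf := by
    have hmul := hf.map_mul hP.isClosed hP.comm
    let Q : A →ₗ[ℂ] B := P.codRestrict B.toSubmodule hP.mem
    have hQ : IsState (f ∘ₗ Q) := by
      refine ⟨fun a => ?_, ?_⟩
      · let _ := CStarAlgebra.spectralOrder A
        let _ := CStarAlgebra.spectralOrderedRing A
        obtain ⟨c, hc, h⟩ := exists_sqrt_mem hP.isClosed (hP.mem _) (hP.nonneg a)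
        have : Q (star a * a) = star (⟨c, hc⟩ : B) * ⟨c, hc⟩ := Subtype.ext h.symm
        rw [LinearMap.comp_apply, this]
        exact hf.1.1 _
      · have : Q 1 = 1 := Subtype.ext (hP.map_of_mem 1 (one_mem B))
        rw [LinearMap.comp_apply, this]
        exact hf.1.2
    have hQB : ∀ b : B, (f ∘ₗ Q) b = f b := fun b =>
      congrArg f (Subtype.ext (hP.map_of_mem b b.2))
    refine ⟨f ∘ₗ Q, ⟨hQ, hQB⟩, fun g ⟨hg, hgf⟩ => ?_⟩
    refine hP.linearMap_eq hg.continuous hQ.continuous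
      (fun b hb => (hgf ⟨b, hb⟩).trans (hQB ⟨b, hb⟩).symm) fun b hb a c hc hbc => ?_
    have h1 : (f ∘ₗ Q) (b * a * c) = 0 := by
      have : Q (b * a * c) = 0 := Subtype.ext (hP.map_mul_mul hb hc hbc a)
      rw [LinearMap.comp_apply, this, map_zero]
    have hzero : ∀ x : B, f x = 0 → g (star (x : A) * x) = 0 := fun x hx => by
      have := hgf (star x * x)
      rw [hmul, hx, mul_zero] at this
      exact this
    have h2 : f ⟨b, hb⟩ * f ⟨c, hc⟩ = 0 := by
      rw [← hmul]
      have : (⟨b, hb⟩ : B) * ⟨c, hc⟩ = 0 := Subtype.ext hbc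
      rw [this, map_zero]
    rw [h1]
    -- The character `f` kills one of the two outer factors, and Cauchy–Schwarz for the extension
    -- `g` does the rest.
    rcases mul_eq_zero.1 h2 with h3 | h3
    · have h4 : g (star (star b) * star b) = 0 := by
        rw [star_star, hP.comm b hb _ (star_mem hb)]
        exact hzero ⟨b, hb⟩ h3
      have := (positive_mul_eq_zero g hg.1 h4 (star (a * c))).2
      rwa [star_star, star_star, ← mul_assoc] at this
    · exact (positive_mul_eq_zero g hg.1 (hzero ⟨c, hc⟩ h3) (b * a)).1

end IsDiagonalPair

end Diagonal

/-! ### Isometry modulo an ideal -/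

section Ideal

/-- `f` is a tent of radius `ε` at `l`, nonzero because `l` is in the spectrum. `h` is `1` on the
support of `f` and vanishes where `|t - l| ≥ 2ε`, so `(l - c) h` is small without affecting products
with `f`. -/
theorem exists_cutoff_spectrum {D : Type*} [CStarAlgebra D] {c : D} (hc : IsSelfAdjoint c) {l : ℝ}
    (hl : l ∈ spectrum ℝ c) {ε : ℝ} (hε : 0 < ε) :
    ∃ f h : D, f ≠ 0 ∧ f * (algebraMap ℝ D l - c) * h = f * (algebraMap ℝ D l - c) ∧
      ‖(algebraMap ℝ D l - c) * h‖ ≤ 2 * ε := by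
  set F : ℝ → ℝ := fun t => max 0 (1 - |t - l| / ε)
  set H : ℝ → ℝ := fun t => min 1 (max 0 (2 - |t - l| / ε))
  have hF : Continuous F := by fun_prop
  have hH : Continuous H := by fun_prop
  have hg : algebraMap ℝ D l - c = cfc (fun t : ℝ => l - t) c := by
    rw [cfc_sub .., cfc_const l c, cfc_id' ℝ c]
  have hFH : ∀ t, F t * H t = F t := fun t => by
    by_cases ht : |t - l| / ε ≤ 1
    · have : H t = 1 := min_eq_left (le_max_of_le_right (by linarith))
      rw [this, mul_one]
    · have : F t = 0 := max_eq_left (by linarith)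
      rw [this, zero_mul]
  refine ⟨cfc F c, cfc H c, fun h0 => ?_, ?_, ?_⟩
  · have hmem : F l ∈ spectrum ℝ (cfc F c) := by
      rw [cfc_map_spectrum F c]
      exact ⟨l, hl, rfl⟩
    have h1 : F l = 1 := by simp [F]
    have : Nontrivial D := by
      by_contra hD
      have := not_nontrivial_iff_subsingleton.1 hD
      simp [spectrum.of_subsingleton] at hl
    rw [h0, h1, spectrum.zero_eq] at hmem
    exact one_ne_zero hmem
  · rw [hg, ← cfc_mul F _ c, ← cfc_mul _ H c]
    exact cfc_congr fun t _ => by rw [mul_right_comm, hFH]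
  · rw [hg, ← cfc_mul _ H c]
    refine norm_cfc_le (by positivity) fun t _ => ?_
    rw [norm_mul, Real.norm_eq_abs, Real.norm_eq_abs, abs_sub_comm]
    by_cases ht : |t - l| / ε ≤ 2
    · rw [div_le_iff₀ hε] at ht
      have : |H t| ≤ 1 := by
        rw [abs_of_nonneg (le_min zero_le_one (le_max_left _ _))]
        exact min_le_left _ _
      nlinarith [abs_nonneg (t - l), abs_nonneg (H t)]
    · have : H t = 0 := by
        simp only [H]
        rw [max_eq_left (by linarith), min_eq_right zero_le_one]
      rw [this, abs_zero, mul_zero]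
      positivity

/-- A *-homomorphism whose image meets a two-sided ideal trivially is isometric modulo the ideal
(on self-adjoint elements). -/
theorem norm_le_norm_sub_of_ideal {D L : Type*} [CStarAlgebra D] [CStarAlgebra L]
    (ψ : D →⋆ₐ[ℂ] L) (K : AddSubgroup L) (hl : ∀ x, ∀ a ∈ K, x * a ∈ K)
    (hr : ∀ a ∈ K, ∀ x, a * x ∈ K) (hK : ∀ d, ψ d ∈ K → d = 0) {c : D} (hc : IsSelfAdjoint c)
    {k : L} (hk : k ∈ K) : ‖c‖ ≤ ‖ψ c - k‖ := by
  nontriviality D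
  by_contra! hlt
  obtain ⟨l, hls, hlc⟩ : ∃ l ∈ spectrum ℝ c, |l| = ‖c‖ := by
    rcases CStarAlgebra.norm_or_neg_norm_mem_spectrum (a := c) with h | h
    · exact ⟨_, h, abs_norm c⟩
    · exact ⟨_, h, by simp⟩
  have hLn : Nontrivial L := by
    by_contra hL
    have := not_nontrivial_iff_subsingleton.1 hL
    exact one_ne_zero (hK 1 (Subsingleton.elim (0 : L) (ψ 1) ▸ K.zero_mem))
  have hu : IsUnit (algebraMap ℝ L l - (ψ c - k)) := by
    refine spectrum.mem_resolventSet_of_norm_lt (𝕜 := ℝ) ?_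
    rwa [Real.norm_eq_abs, hlc]
  obtain ⟨w, hw⟩ := hu.exists_right_inv
  -- With `w` the inverse of `l - (ψ c - k)`, this width makes `‖ψ M * w‖ < 1` for `M = (l - c) h`.
  obtain ⟨f, h, hf0, hfh, hn⟩ := exists_cutoff_spectrum hc hls
    (ε := (4 * (‖w‖ + 1))⁻¹) (by positivity)
  obtain ⟨M, hM⟩ : ∃ M, M = (algebraMap ℝ D l - c) * h := ⟨_, rfl⟩
  have hMw : ‖ψ M * w‖ < 1 := by
    have h1 : ‖ψ M‖ ≤ 2 * (4 * (‖w‖ + 1))⁻¹ :=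
      (NonUnitalStarAlgHom.norm_apply_le ψ M).trans (hM ▸ hn)
    calc ‖ψ M * w‖ ≤ ‖ψ M‖ * ‖w‖ := norm_mul_le _ _
      _ ≤ 2 * (4 * (‖w‖ + 1))⁻¹ * ‖w‖ := by gcongr
      _ = 2 * ‖w‖ / (4 * (‖w‖ + 1)) := by ring
      _ < 1 := by
        rw [div_lt_one (by positivity)]
        linarith [norm_nonneg w]
  obtain ⟨v, hv⟩ := (isUnit_one_sub_of_norm_lt_one hMw).exists_right_inv
  have hψ : ψ (algebraMap ℝ D l) = algebraMap ℝ L l := AlgHomClass.commutes ψ (l : ℂ)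
  -- Modulo the ideal `w` inverts `l - ψ c`, so `ψ f` and `ψ f * ψ M * w` agree there. As `1 - ψ M *
  -- w` is invertible, `ψ f` lies in the ideal although `f ≠ 0`.
  have h1 : ψ f * (1 - ψ M * w) = ψ f * k * w := by
    have e1 : ψ f * ψ M = ψ f * (algebraMap ℝ L l - ψ c) := by
      rw [← map_mul, hM, ← mul_assoc, hfh, map_mul, map_sub, hψ]
    have e2 : ψ f * ((algebraMap ℝ L l - (ψ c - k)) * w) = ψ f := by rw [hw, mul_one]
    rw [mul_sub, mul_one, ← mul_assoc, e1]
    nth_rewrite 1 [← e2]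
    noncomm_ring
  have h2 : ψ f = ψ f * k * w * v := by rw [← h1, mul_assoc, hv, mul_one]
  exact hf0 (hK f (h2 ▸ hr _ (hr _ (hl _ k hk) w) v))

end Ideal

/-! ### Equivariance under normalizers; the null ideal -/

namespace IsDiagonalExpectation

variable {A : Type u} [CStarAlgebra A] {B : StarSubalgebra ℂ A} {P : A →ₗ[ℂ] A}

/-- By density only `b * a * c` with `b * c = 0` needs an argument. Multiplying `n* (b a c) n` by
`n* n` on both sides turns it into `(n* b n)(n* a n)(n* c n)`, whose outer factors again have
product zero. -/
theorem map_star_mul_mul (hP : IsDiagonalExpectation B P) {n : A} (hn : n ∈ normalizers B)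
    (x : A) : P (star n * x * n) = star n * P x * n := by
  have hconj : ∀ b ∈ B, star n * b * n ∈ B := fun b hb => (hn b hb).2
  have he : star n * n ∈ B := by simpa using hconj 1 (one_mem B)
  have hf : n * star n ∈ B := by simpa using (hn 1 (one_mem B)).1
  suffices h : P ∘ₗ LinearMap.mulLeftRight ℂ (star n, n) =
      LinearMap.mulLeftRight ℂ (star n, n) ∘ₗ P from LinearMap.congr_fun h x
  refine hP.linearMap_eq (hP.continuous.comp ?_) ?_
    (fun b hb => ?_) fun b hb a c hc hbc => ?_
  · exact (continuous_const.mul continuous_id).mul continuous_const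
  · exact (continuous_const.mul hP.continuous).mul continuous_const
  · simp only [LinearMap.comp_apply, LinearMap.mulLeftRight_apply]
    rw [hP.map_of_mem _ (hconj b hb), hP.map_of_mem b hb]
  · simp only [LinearMap.comp_apply, LinearMap.mulLeftRight_apply]
    rw [hP.map_mul_mul hb hc hbc, mul_zero, zero_mul]
    obtain ⟨d, hd⟩ : ∃ d, d = P (star n * (b * a * c) * n) := ⟨_, rfl⟩
    have hdB : d ∈ B := hd ▸ hP.mem _
    rw [← hd]
    have h1 : star n * n * d * (star n * n) = 0 := by
      have e1 : star n * n * (star n * (b * a * c) * n) * (star n * n) =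
          (star n * b * n) * (star n * a * n) * (star n * c * n) := by
        have h2 := hP.comm _ hf b hb
        have h3 := hP.comm _ hf c hc
        calc star n * n * (star n * (b * a * c) * n) * (star n * n)
            = star n * ((n * star n) * b) * a * (c * (n * star n)) * n := by noncomm_ring
          _ = star n * (b * (n * star n)) * a * ((n * star n) * c) * n := by rw [h2, h3]
          _ = _ := by noncomm_ring
      have e2 : (star n * b * n) * (star n * c * n) = 0 := by
        calc (star n * b * n) * (star n * c * n) = star n * (b * (n * star n)) * c * n := by
              noncomm_ring
          _ = star n * (n * star n) * (b * c) * n := by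
              rw [← hP.comm _ hf b hb]; noncomm_ring
          _ = 0 := by rw [hbc, mul_zero, zero_mul]
      rw [hd, ← hP.map_mul_left _ he, ← hP.map_mul_right _ he, e1]
      exact hP.map_mul_mul (hconj b hb) (hconj c hc) e2 _
    have h2 : star n * n * d = 0 := by
      rw [← CStarRing.star_mul_self_eq_zero_iff]
      calc star (star n * n * d) * (star n * n * d)
          = star d * (star n * n * (star n * n * d)) := by simp [mul_assoc]
        _ = star d * (star n * n * d * (star n * n)) := by
            rw [hP.comm _ he (star n * n * d) (mul_mem he hdB)]
        _ = 0 := by rw [h1, mul_zero]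
    -- The factor `n* n` is removed by positivity: `n d* = 0` gives `d d* = P (n* (b a c) n d*) =
    -- 0`.
    have h3 : n * star d = 0 := by
      rw [← CStarRing.star_mul_self_eq_zero_iff]
      calc star (n * star d) * (n * star d) = d * (star n * n) * star d := by simp [mul_assoc]
        _ = 0 := by rw [hP.comm d hdB _ he, h2, zero_mul]
    rw [← CStarRing.mul_star_self_eq_zero_iff]
    nth_rewrite 1 [hd]
    rw [← hP.map_mul_right _ (star_mem hdB), mul_assoc, h3, mul_zero, map_zero]

/-- The null elements form a closed left ideal `K`. Its right multipliers form a closed subalgebra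
`S`, which contains the normalizers by equivariance and hence is everything. -/
theorem map_star_mul_self_mul_eq_zero (hP : IsDiagonalExpectation B P) {a : A}
    (ha : P (star a * a) = 0) (x : A) : P (star (a * x) * (a * x)) = 0 := by
  let K : Submodule ℂ A :=
    { carrier := {a | ∀ y, P (y * a) = 0}
      zero_mem' := fun y => by simp
      add_mem' := fun h1 h2 y => by rw [mul_add, map_add, h1, h2, add_zero]
      smul_mem' := fun c z h y => by rw [mul_smul_comm, map_smul, h, smul_zero] }
  have hKc : IsClosed (K : Set A) := by
    have : (K : Set A) = ⋂ y, {a | P (y * a) = 0} := by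
      ext; simp [K]
    rw [this]
    exact isClosed_iInter fun y => isClosed_eq
      (hP.continuous.comp (continuous_const.mul continuous_id)) continuous_const
  have hKP : ∀ a, a ∈ K ↔ P (star a * a) = 0 := fun a =>
    ⟨fun h => h _, fun h => hP.map_mul_eq_zero h⟩
  let S : Subalgebra ℂ A :=
    { carrier := {x | ∀ a ∈ K, a * x ∈ K}
      mul_mem' := fun h1 h2 a ha => by
        rw [← mul_assoc]
        exact h2 _ (h1 a ha)
      add_mem' := fun h1 h2 a ha => by
        rw [mul_add]
        exact K.add_mem (h1 a ha) (h2 a ha)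
      algebraMap_mem' := fun c a ha => by
        rw [← Algebra.commutes, ← Algebra.smul_def]
        exact K.smul_mem c ha }
  have hSc : IsClosed (S : Set A) := by
    have : (S : Set A) = ⋂ a ∈ K, {x | a * x ∈ K} := by
      ext; simp [S]
    rw [this]
    exact isClosed_biInter fun a _ => hKc.preimage (continuous_const.mul continuous_id)
  have hnS : normalizers B ⊆ S := fun n hn a ha => by
    rw [hKP] at ha ⊢
    have := hP.map_star_mul_mul hn (star a * a)
    rw [ha, mul_zero, zero_mul] at this
    rw [← this, star_mul]
    simp only [mul_assoc]
  have hle : (StarAlgebra.adjoin ℂ (normalizers B)).toSubalgebra ≤ S := by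
    rw [StarAlgebra.adjoin_toSubalgebra, Algebra.adjoin_le_iff, Set.union_subset_iff]
    refine ⟨hnS, fun n hn => hnS fun b hb => ?_⟩
    have := hn b hb
    rw [star_star] at this
    exact this.symm
  have hx : x ∈ (StarAlgebra.adjoin ℂ (normalizers B)).topologicalClosure := by
    rw [hP.regular]
    trivial
  exact (hKP _).1 (closure_minimal (t := (S : Set A)) hle hSc hx a ((hKP a).2 ha))

end IsDiagonalExpectation

theorem StarAlgHom.continuous_of_cstar {A A' : Type*} [CStarAlgebra A] [CStarAlgebra A']
    (φ : A →⋆ₐ[ℂ] A') : Continuous φ :=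
  AddMonoidHomClass.continuous_of_bound φ 1 fun a => by
    rw [one_mul]
    exact NonUnitalStarAlgHom.norm_apply_le φ a

namespace IsDiagonalExpectation

variable {A : Type u} [CStarAlgebra A] {B : StarSubalgebra ℂ A} {P : A →ₗ[ℂ] A}

/-- Diagonal expectations are compatible with *-homomorphisms that respect the subalgebras. -/
theorem map_comm (hP : IsDiagonalExpectation B P) {A' : Type*} [CStarAlgebra A']
    {B' : StarSubalgebra ℂ A'} {P' : A' →ₗ[ℂ] A'} (hP' : IsDiagonalExpectation B' P')
    (φ : A →⋆ₐ[ℂ] A') (hφ : ∀ b ∈ B, φ b ∈ B') (a : A) : P' (φ a) = φ (P a) := by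
  have hc : Continuous φ := φ.continuous_of_cstar
  suffices h : P' ∘ₗ φ.toAlgHom.toLinearMap = φ.toAlgHom.toLinearMap ∘ₗ P from
    LinearMap.congr_fun h a
  refine hP.linearMap_eq (hP'.continuous.comp hc) (hc.comp hP.continuous) (fun b hb => ?_)
    fun b hb a c hc hbc => ?_
  · change P' (φ b) = φ (P b)
    rw [hP.map_of_mem b hb, hP'.map_of_mem _ (hφ b hb)]
  · change P' (φ (b * a * c)) = φ (P (b * a * c))
    rw [hP.map_mul_mul hb hc hbc, map_zero, map_mul φ, map_mul φ]
    exact hP'.map_mul_mul (hφ b hb) (hφ c hc) (by rw [← map_mul, hbc, map_zero]) _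

end IsDiagonalExpectation

/-! ### Passage to the inductive limit -/

namespace IsInductiveLimit

variable {A : ℕ → Type u} [∀ n, CStarAlgebra (A n)] {φ : ∀ n, A n →⋆ₐ[ℂ] A (n + 1)}
  {L : Type v} [CStarAlgebra L] {ψ : ∀ n, A n →⋆ₐ[ℂ] L}

theorem norm_map (h : IsInductiveLimit φ L ψ) (hinj : ∀ n, Function.Injective (φ n)) (n : ℕ)
    (a : A n) : ‖ψ n a‖ = ‖a‖ := by
  have hk : ∀ k, ‖connectingMap φ n k a‖ = ‖a‖ := fun k => by
    induction k with
    | zero => rfl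
    | succ k ih => exact (NonUnitalStarAlgHom.norm_map (φ (n + k)) (hinj _) _).trans ih
  have := h.norm_eq n a
  simp only [hk] at this
  exact tendsto_nhds_unique this tendsto_const_nhds

theorem injective (h : IsInductiveLimit φ L ψ) (hinj : ∀ n, Function.Injective (φ n)) (n : ℕ) :
    Function.Injective (ψ n) := by
  rw [injective_iff_map_eq_zero]
  intro a ha
  rw [← norm_eq_zero, ← h.norm_map hinj, ha, norm_zero]

variable {B : ∀ n, StarSubalgebra ℂ (A n)} {P : ∀ n, A n →ₗ[ℂ] A n}

/-- The closed subalgebra of the limit generated by the subalgebras `B n`. -/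
def limitSubalgebra (ψ : ∀ n, A n →⋆ₐ[ℂ] L) (B : ∀ n, StarSubalgebra ℂ (A n)) :
    StarSubalgebra ℂ L :=
  (⨆ n, (B n).map (ψ n)).topologicalClosure

theorem map_mono (h : IsInductiveLimit φ L ψ) (hB : ∀ n, ∀ b ∈ B n, φ n b ∈ B (n + 1)) :
    Monotone fun n => (B n).map (ψ n) := by
  refine monotone_nat_of_le_succ fun n => ?_
  rintro _ ⟨b, hb, rfl⟩
  exact ⟨φ n b, hB n b hb, h.compatible n b⟩

theorem coe_limitSubalgebra (h : IsInductiveLimit φ L ψ)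
    (hB : ∀ n, ∀ b ∈ B n, φ n b ∈ B (n + 1)) :
    (limitSubalgebra ψ B : Set L) = closure (⋃ n, ψ n '' (B n)) := by
  rw [limitSubalgebra, StarSubalgebra.topologicalClosure_coe,
    StarSubalgebra.coe_iSup_of_directed (h.map_mono hB).directed_le]
  rfl

theorem map_mem_limitSubalgebra (h : IsInductiveLimit φ L ψ)
    (hB : ∀ n, ∀ b ∈ B n, φ n b ∈ B (n + 1)) {n : ℕ} {b : A n} (hb : b ∈ B n) :
    ψ n b ∈ limitSubalgebra ψ B := by
  rw [← SetLike.mem_coe, h.coe_limitSubalgebra hB]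
  exact subset_closure (Set.mem_iUnion.2 ⟨n, b, hb, rfl⟩)

/-- A closed condition holds on the limit subalgebra if it holds on each `B n`. -/
theorem limitSubalgebra_induction (h : IsInductiveLimit φ L ψ)
    (hB : ∀ n, ∀ b ∈ B n, φ n b ∈ B (n + 1)) {p : L → Prop} (hp : IsClosed {x | p x})
    (hn : ∀ n, ∀ b ∈ B n, p (ψ n b)) {x : L} (hx : x ∈ limitSubalgebra ψ B) : p x := by
  rw [← SetLike.mem_coe, h.coe_limitSubalgebra hB] at hx
  refine closure_minimal ?_ hp hx
  rintro _ hx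
  obtain ⟨n, b, hb, rfl⟩ := Set.mem_iUnion.1 hx
  exact hn n b hb

theorem limit_induction (h : IsInductiveLimit φ L ψ) {p : L → Prop} (hp : IsClosed {x | p x})
    (hn : ∀ n a, p (ψ n a)) (x : L) : p x := by
  refine closure_minimal ?_ hp (h.dense x)
  rintro _ hx
  obtain ⟨n, a, rfl⟩ := Set.mem_iUnion.1 hx
  exact hn n a

/-- Moves elements of different stages to a common later stage, where their algebraic relations can
be checked. -/
theorem exists_lift (h : IsInductiveLimit φ L ψ) (hB : ∀ n, ∀ b ∈ B n, φ n b ∈ B (n + 1))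
    (hP : ∀ n a, P (n + 1) (φ n a) = φ n (P n a)) {n m : ℕ} (hnm : n ≤ m) (a : A n) :
    ∃ a' : A m, ψ m a' = ψ n a ∧ (a ∈ B n → a' ∈ B m) ∧ ψ m (P m a') = ψ n (P n a) := by
  induction m, hnm using Nat.le_induction with
  | base => exact ⟨a, rfl, id, rfl⟩
  | succ m _ ih =>
    obtain ⟨a', h1, h2, h3⟩ := ih
    exact ⟨φ m a', (h.compatible m a').trans h1, fun ha => hB m a' (h2 ha), by
      rw [hP, h.compatible, h3]⟩

theorem exists_limit_expectation (h : IsInductiveLimit φ L ψ)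
    (hinj : ∀ n, Function.Injective (φ n)) (hB : ∀ n, ∀ b ∈ B n, φ n b ∈ B (n + 1))
    (hP : ∀ n a, P (n + 1) (φ n a) = φ n (P n a)) (hPn : ∀ n a, ‖P n a‖ ≤ ‖a‖) :
    ∃ Q : L →L[ℂ] L, ∀ n a, Q (ψ n a) = ψ n (P n a) := by
  have hmono : Monotone fun n => LinearMap.range (ψ n).toAlgHom.toLinearMap := by
    refine monotone_nat_of_le_succ fun n => ?_
    rintro _ ⟨a, rfl⟩
    exact ⟨φ n a, h.compatible n a⟩
  let V : Submodule ℂ L := ⨆ n, LinearMap.range (ψ n).toAlgHom.toLinearMap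
  have hV : ∀ x, x ∈ V ↔ ∃ n, ∃ a, ψ n a = x := fun x =>
    Submodule.mem_iSup_of_directed _ hmono.directed_le
  -- Independence of the representative: both are moved to stage `max n m`, where injectivity of the
  -- canonical map identifies them.
  have hwd : ∀ n m (a : A n) (b : A m), ψ n a = ψ m b → ψ n (P n a) = ψ m (P m b) :=
    fun n m a b hab => by
      obtain ⟨a', h1, -, h2⟩ := h.exists_lift hB hP (le_max_left n m) a
      obtain ⟨b', h3, -, h4⟩ := h.exists_lift hB hP (le_max_right n m) b
      rw [← h2, ← h4, h.injective hinj _ (h1.trans (hab.trans h3.symm))]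
  choose N a ha using fun x : V => (hV x).1 x.2
  have hf : ∀ (x : V) n (b : A n), ψ n b = x → ψ (N x) (P _ (a x)) = ψ n (P n b) :=
    fun x n b hb => hwd _ _ _ _ ((ha x).trans hb.symm)
  let f : V →ₗ[ℂ] L :=
    { toFun := fun x => ψ (N x) (P _ (a x))
      map_add' := fun x y => by
        obtain ⟨a', h1, -, h2⟩ := h.exists_lift hB hP (le_max_left (N x) (N y)) (a x)
        obtain ⟨b', h3, -, h4⟩ := h.exists_lift hB hP (le_max_right (N x) (N y)) (a y)
        rw [← h2, ← h4, ← map_add, ← map_add]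
        refine hf _ _ _ ?_
        rw [map_add, h1, h3, ha, ha]
        rfl
      map_smul' := fun c x => by
        rw [RingHom.id_apply, ← map_smul, ← map_smul]
        refine hf _ _ _ ?_
        rw [map_smul, ha]
        rfl }
  have hfn : ∀ x, ‖f x‖ ≤ 1 * ‖x‖ := fun x => by
    rw [one_mul]
    calc ‖f x‖ = ‖P _ (a x)‖ := h.norm_map hinj _ _
      _ ≤ ‖a x‖ := hPn _ _
      _ = ‖ψ _ (a x)‖ := (h.norm_map hinj _ _).symm
      _ = ‖x‖ := by rw [ha]; rfl
  have hd : DenseRange V.subtypeL := by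
    rw [DenseRange]
    refine h.dense.mono fun x hx => ?_
    obtain ⟨n, a, rfl⟩ := Set.mem_iUnion.1 hx
    exact ⟨⟨ψ n a, (hV _).2 ⟨n, a, rfl⟩⟩, rfl⟩
  refine ⟨(f.mkContinuous 1 hfn).extend V.subtypeL, fun n b => ?_⟩
  have := ContinuousLinearMap.extend_eq (f.mkContinuous 1 hfn) hd
    isUniformEmbedding_subtype_val.isUniformInducing ⟨ψ n b, (hV _).2 ⟨n, b, rfl⟩⟩
  exact this.trans (hf _ n b rfl)

theorem isDiagonalExpectation (h : IsInductiveLimit φ L ψ)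
    (hB : ∀ n, ∀ b ∈ B n, φ n b ∈ B (n + 1)) (hP : ∀ n, IsDiagonalExpectation (B n) (P n))
    (hN : ∀ n, ∀ a ∈ normalizers (B n), φ n a ∈ normalizers (B (n + 1)))
    {Q : L →L[ℂ] L} (hQ : ∀ n a, Q (ψ n a) = ψ n (P n a)) :
    IsDiagonalExpectation (limitSubalgebra ψ B) (Q : L →ₗ[ℂ] L) := by
  have hcl : IsClosed (limitSubalgebra ψ B : Set L) := by
    rw [h.coe_limitSubalgebra hB]
    exact isClosed_closure
  have hψ : ∀ n, Continuous (ψ n) := fun n => (ψ n).continuous_of_cstar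
  have hlift : ∀ {n m : ℕ} (hnm : n ≤ m) (a : A n),
      ∃ a' : A m, ψ m a' = ψ n a ∧ (a ∈ B n → a' ∈ B m) := fun hnm a => by
    obtain ⟨a', h1, h2, -⟩ := h.exists_lift hB
      (fun n a => (hP n).map_comm (hP (n + 1)) (φ n) (hB n) a) hnm a
    exact ⟨a', h1, h2⟩
  refine ⟨hcl, fun x hx y hy => ?_, fun a => ?_, fun b hb => ?_, fun b hb a => ?_, fun b hb a => ?_,
    fun a => ?_, ?_, ?_⟩
  · refine h.limitSubalgebra_induction hB (p := fun x => x * y = y * x)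
      (isClosed_eq (by fun_prop) (by fun_prop)) (fun n b hb => ?_) hx
    refine h.limitSubalgebra_induction hB (p := fun y => ψ n b * y = y * ψ n b)
      (isClosed_eq (by fun_prop) (by fun_prop)) (fun m c hc => ?_) hy
    obtain ⟨b', h1, h2⟩ := hlift (le_max_left n m) b
    obtain ⟨c', h3, h4⟩ := hlift (le_max_right n m) c
    rw [← h1, ← h3, ← map_mul, ← map_mul, (hP _).comm _ (h2 hb) _ (h4 hc)]
  · refine h.limit_induction (p := fun a => Q a ∈ limitSubalgebra ψ B)
      (hcl.preimage Q.continuous) (fun n a => ?_) a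
    rw [hQ]
    exact h.map_mem_limitSubalgebra hB ((hP n).mem a)
  · refine h.limitSubalgebra_induction hB (p := fun b => Q b = b)
      (isClosed_eq (by fun_prop) (by fun_prop)) (fun n b hb => ?_) hb
    rw [hQ, (hP n).map_of_mem b hb]
  · refine h.limitSubalgebra_induction hB (p := fun b => Q (b * a) = b * Q a)
      (isClosed_eq (by fun_prop) (by fun_prop)) (fun n b hb => ?_) hb
    refine h.limit_induction (p := fun a => Q (ψ n b * a) = ψ n b * Q a)
      (isClosed_eq (by fun_prop) (by fun_prop)) (fun m a => ?_) a
    obtain ⟨b', h1, h2⟩ := hlift (le_max_left n m) b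
    obtain ⟨a', h3, -⟩ := hlift (le_max_right n m) a
    rw [← h1, ← h3, ← map_mul, hQ, hQ, (hP _).map_mul_left _ (h2 hb), map_mul]
  · refine h.limitSubalgebra_induction hB (p := fun b => Q (a * b) = Q a * b)
      (isClosed_eq (by fun_prop) (by fun_prop)) (fun n b hb => ?_) hb
    refine h.limit_induction (p := fun a => Q (a * ψ n b) = Q a * ψ n b)
      (isClosed_eq (by fun_prop) (by fun_prop)) (fun m a => ?_) a
    obtain ⟨b', h1, h2⟩ := hlift (le_max_left n m) b
    obtain ⟨a', h3, -⟩ := hlift (le_max_right n m) a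
    rw [← h1, ← h3, ← map_mul, hQ, hQ, (hP _).map_mul_right _ (h2 hb), map_mul]
  · let _ := CStarAlgebra.spectralOrder L
    let _ := CStarAlgebra.spectralOrderedRing L
    refine CStarAlgebra.nonneg_iff_eq_star_mul_self.1 ?_
    refine h.limit_induction (p := fun a => 0 ≤ Q (star a * a))
      (CStarAlgebra.isClosed_nonneg.preimage (f := fun a => Q (star a * a)) (by fun_prop)) (fun n a => ?_) a
    obtain ⟨c, hc⟩ := (hP n).positive a
    rw [← map_star, ← map_mul, hQ, hc, map_mul, map_star]
    exact star_mul_self_nonneg _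
  · rw [eq_top_iff]
    refine fun x _ => h.limit_induction
      (p := fun x => x ∈ (Submodule.span ℂ (decomposable (limitSubalgebra ψ B))).topologicalClosure)
      (Submodule.isClosed_topologicalClosure _) (fun n a => ?_) x
    have ha : a ∈ (Submodule.span ℂ (decomposable (B n))).topologicalClosure := by
      rw [(hP n).dense]
      trivial
    refine map_mem_closure (hψ n) ha fun y hy => ?_
    refine (Submodule.span_le (p := (Submodule.span ℂ
      (decomposable (limitSubalgebra ψ B))).comap (ψ n).toAlgHom.toLinearMap)).2 ?_ hy
    rintro z (hz | ⟨b, hb, a, c, hc, hbc, rfl⟩)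
    · exact Submodule.subset_span (Or.inl (h.map_mem_limitSubalgebra hB hz))
    · refine Submodule.subset_span (Or.inr ⟨ψ n b, h.map_mem_limitSubalgebra hB hb, ψ n a, ψ n c,
        h.map_mem_limitSubalgebra hB hc, ?_, ?_⟩)
      · rw [← map_mul, hbc, map_zero]
      · exact (map_mul (ψ n) _ _).trans (congrArg (· * _) (map_mul (ψ n) _ _))
  -- A normalizer of `B n` stays one at every later stage, so in the limit it normalizes a dense
  -- part of the subalgebra, and by closedness all of it.
  · have hNψ : ∀ n, ∀ a ∈ normalizers (B n), ψ n a ∈ normalizers (limitSubalgebra ψ B) := by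
      intro n a ha b hb
      have hlift' : ∀ m, n ≤ m → ∃ a' ∈ normalizers (B m), ψ m a' = ψ n a := fun m hnm => by
        induction m, hnm using Nat.le_induction with
        | base => exact ⟨a, ha, rfl⟩
        | succ m _ ih =>
          obtain ⟨a', h1, h2⟩ := ih
          exact ⟨φ m a', hN m a' h1, (h.compatible m a').trans h2⟩
      refine h.limitSubalgebra_induction hB
        (p := fun b => ψ n a * b * star (ψ n a) ∈ limitSubalgebra ψ B ∧
          star (ψ n a) * b * ψ n a ∈ limitSubalgebra ψ B)
        ((hcl.preimage (f := fun b => ψ n a * b * star (ψ n a)) (by fun_prop)).inter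
          (hcl.preimage (f := fun b => star (ψ n a) * b * ψ n a) (by fun_prop)))
        (fun m b hb => ?_) hb
      obtain ⟨a', h1, h2⟩ := hlift' _ (le_max_left n m)
      obtain ⟨b', h3, h4⟩ := hlift (le_max_right n m) b
      rw [← h2, ← h3, ← map_star, ← map_mul, ← map_mul, ← map_mul, ← map_mul]
      exact ⟨h.map_mem_limitSubalgebra hB (h1 b' (h4 hb)).1,
        h.map_mem_limitSubalgebra hB (h1 b' (h4 hb)).2⟩
    rw [eq_top_iff]
    refine fun x _ => h.limit_induction
      (p := fun x => x ∈ (StarAlgebra.adjoin ℂ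
        (normalizers (limitSubalgebra ψ B))).topologicalClosure)
      (StarSubalgebra.isClosed_topologicalClosure _) (fun n a => ?_) x
    have ha : a ∈ (StarAlgebra.adjoin ℂ (normalizers (B n))).topologicalClosure := by
      rw [(hP n).regular]
      trivial
    refine map_mem_closure (hψ n) ha fun y hy => ?_
    refine (StarAlgebra.adjoin_le (S := (StarAlgebra.adjoin ℂ
      (normalizers (limitSubalgebra ψ B))).comap (ψ n)) fun z hz => ?_) hy
    exact StarAlgebra.subset_adjoin ℂ _ (hNψ n z hz)

/-- Faithfulness is not a closed condition, so density alone does not give it. If `a` is null, then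
`a* a` lies in an ideal that no stage meets. An approximant `ψ n d` of `a* a` then satisfies `‖d‖ ≤
‖ψ n d - a* a‖`, so it is small. -/
theorem isDiagonalPair (h : IsInductiveLimit φ L ψ) (hinj : ∀ n, Function.Injective (φ n))
    (hB : ∀ n, ∀ b ∈ B n, φ n b ∈ B (n + 1)) (hP : ∀ n, IsDiagonalPair (B n) (P n))
    (hN : ∀ n, ∀ a ∈ normalizers (B n), φ n a ∈ normalizers (B (n + 1)))
    {Q : L →L[ℂ] L} (hQ : ∀ n a, Q (ψ n a) = ψ n (P n a)) :
    IsDiagonalPair (limitSubalgebra ψ B) (Q : L →ₗ[ℂ] L) := by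
  have hE := h.isDiagonalExpectation hB (fun n => (hP n).toIsDiagonalExpectation) hN hQ
  refine ⟨hE, fun a ha => ?_⟩
  let K : AddSubgroup L :=
    { carrier := {a | ∀ y, Q (y * a) = 0}
      zero_mem' := fun y => by simp
      add_mem' := fun h1 h2 y => by rw [mul_add, map_add, h1, h2, add_zero]
      neg_mem' := fun h y => by rw [mul_neg, map_neg, h, neg_zero] }
  have hKP : ∀ a, a ∈ K ↔ Q (star a * a) = 0 := fun a =>
    ⟨fun h => h _, fun h => hE.map_mul_eq_zero h⟩
  have hl : ∀ x, ∀ a ∈ K, x * a ∈ K := fun x a ha y => by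
    rw [← mul_assoc]
    exact ha _
  have hr : ∀ a ∈ K, ∀ x, a * x ∈ K := fun a ha x =>
    (hKP _).2 (hE.map_star_mul_self_mul_eq_zero ((hKP a).1 ha) x)
  have hK : ∀ n d, ψ n d ∈ K → d = 0 := fun n d hd => by
    rw [hKP, ← map_star, ← map_mul, hQ] at hd
    exact (hP n).faithful d (h.injective hinj n (hd.trans (map_zero _).symm))
  have hk : star a * a ∈ K := hl _ _ ((hKP a).2 ha)
  rw [← CStarRing.star_mul_self_eq_zero_iff, ← norm_le_zero_iff]
  refine le_of_forall_pos_le_add fun ε hε => ?_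
  obtain ⟨x, hx, hxa⟩ := Metric.mem_closure_iff.1 (h.dense (star a * a)) (ε / 2) (by positivity)
  obtain ⟨n, c, rfl⟩ := Set.mem_iUnion.1 hx
  rw [dist_comm, dist_eq_norm] at hxa
  -- The real part is no worse an approximant, as `a* a` is self-adjoint.
  obtain ⟨d, hd⟩ : ∃ d, d = (1 / 2 : ℂ) • (c + star c) := ⟨_, rfl⟩
  have hds : IsSelfAdjoint d := by
    rw [IsSelfAdjoint, hd]
    simp [add_comm]
  have hdn : ‖ψ n d - star a * a‖ < ε / 2 := by
    have e : ψ n d - star a * a =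
        (1 / 2 : ℂ) • ((ψ n c - star a * a) + star (ψ n c - star a * a)) := by
      rw [hd, map_smul, map_add, map_star, star_sub, star_mul, star_star]
      module
    rw [e, norm_smul]
    have := norm_add_le (ψ n c - star a * a) (star (ψ n c - star a * a))
    rw [norm_star] at this
    have h2 : ‖(1 / 2 : ℂ)‖ = 1 / 2 := by simp
    rw [h2]
    linarith
  have h1 := norm_le_norm_sub_of_ideal (ψ n) K hl hr (hK n) hds hk
  have h2 := norm_sub_le (ψ n d) (ψ n d - star a * a)
  rw [sub_sub_cancel, h.norm_map hinj] at h2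
  linarith

end IsInductiveLimit

theorem IsInductiveLimit.exists_isCStarDiagonal {A : ℕ → Type u} [∀ n, CStarAlgebra (A n)]
    {φ : ∀ n, A n →⋆ₐ[ℂ] A (n + 1)} {L : Type v} [CStarAlgebra L] {ψ : ∀ n, A n →⋆ₐ[ℂ] L}
    (h : IsInductiveLimit φ L ψ) (hinj : ∀ n, Function.Injective (φ n))
    {B : ∀ n, StarSubalgebra ℂ (A n)} (hB : ∀ n, ∀ b ∈ B n, φ n b ∈ B (n + 1))
    (hP : ∀ n, ∃ P, IsDiagonalPair (B n) P)
    (hN : ∀ n, ∀ a ∈ normalizers (B n), φ n a ∈ normalizers (B (n + 1))) :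
    ∃ B : StarSubalgebra ℂ L, IsCStarDiagonal B := by
  choose P hP using hP
  obtain ⟨Q, hQ⟩ := h.exists_limit_expectation hinj hB
    (fun n a => (hP n).map_comm (hP (n + 1)).toIsDiagonalExpectation (φ n) (hB n) a)
    (fun n => (hP n).norm_map_le)
  exact ⟨_, (h.isDiagonalPair hinj hB hP hN hQ).isCStarDiagonal⟩

/-! ### Diagonal expectations from finite frames -/

section Frame

theorem isClosed_of_mem_iff_commute {A : Type u} [CStarAlgebra A] {B : StarSubalgebra ℂ A}
    (hB : ∀ a, a ∈ B ↔ ∀ b ∈ B, b * a = a * b) : IsClosed (B : Set A) := by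
  have : (B : Set A) = ⋂ b ∈ B, {a | b * a = a * b} := by
    ext a
    simpa using hB a
  rw [this]
  exact isClosed_biInter fun b _ => isClosed_eq (by fun_prop) (by fun_prop)

/-- Every `a` is the finite sum of the `e i j * a * e i k`. Terms with `j = k` lie in `B` and make
up `P a`; the others have outer factors with product zero. Each term is a normalizer, because
conjugating `B` by it lands in a corner `e i j * A * e i j ⊆ B`. -/
theorem exists_isDiagonalPair_of_frame {A : Type u} [CStarAlgebra A] {B : StarSubalgebra ℂ A}
    (hB : ∀ a, a ∈ B ↔ ∀ b ∈ B, b * a = a * b) {I : Type*} [Fintype I] {J : I → Type*}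
    [∀ i, Fintype (J i)] (e : ∀ i, J i → A) (he : ∀ i j, e i j ∈ B)
    (hsa : ∀ i j, star (e i j) = e i j) (hcorner : ∀ i j x, e i j * x * e i j ∈ B)
    (hort : ∀ i j k, j ≠ k → e i j * e i k = 0)
    (hsum : ∀ a, ∑ i, (∑ j, e i j) * a * (∑ k, e i k) = a) :
    ∃ P, IsDiagonalPair B P := by
  have hcomm : ∀ x ∈ B, ∀ y ∈ B, x * y = y * x := fun x hx y hy => (hB y).1 hy x hx
  have hsum' : ∀ a, ∑ i, ∑ j, ∑ k, e i j * a * e i k = a := fun a => by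
    conv_rhs => rw [← hsum a]
    refine Finset.sum_congr rfl fun i _ => ?_
    simp only [Finset.sum_mul, Finset.mul_sum]
    exact Finset.sum_comm
  have hN : ∀ i j k a, e i j * a * e i k ∈ normalizers B := fun i j k a b hb => by
    refine ⟨?_, ?_⟩
    · convert hcorner i j (a * e i k * b * e i k * star a) using 1
      simp only [star_mul, hsa, mul_assoc]
    · convert hcorner i k (star a * e i j * b * e i j * a) using 1
      simp only [star_mul, hsa, mul_assoc]
  have hcl := isClosed_of_mem_iff_commute hB
  let P : A →ₗ[ℂ] A := ∑ i, ∑ j, LinearMap.mulLeftRight ℂ (e i j, e i j)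
  have hPa : ∀ a, P a = ∑ i, ∑ j, e i j * a * e i j := fun a => by
    simp [P, LinearMap.sum_apply]
  refine ⟨P, ⟨hcl, hcomm, fun a => ?_, fun b hb => ?_, fun b hb a => ?_, fun b hb a => ?_,
    fun a => ?_, ?_, ?_⟩, fun a ha => ?_⟩
  · rw [hPa]
    exact sum_mem fun i _ => sum_mem fun j _ => hcorner i j a
  · rw [hPa]
    conv_rhs => rw [← hsum' b]
    refine Finset.sum_congr rfl fun i _ => Finset.sum_congr rfl fun j _ => ?_
    rw [Finset.sum_eq_single j]
    · intro k _ hk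
      rw [hcomm _ (he i j) b hb, mul_assoc, hort i j k hk.symm, mul_zero]
    · exact fun h => absurd (Finset.mem_univ j) h
  · rw [hPa, hPa, Finset.mul_sum]
    refine Finset.sum_congr rfl fun i _ => ?_
    rw [Finset.mul_sum]
    refine Finset.sum_congr rfl fun j _ => ?_
    rw [← mul_assoc, hcomm _ (he i j) b hb]
    simp only [mul_assoc]
  · rw [hPa, hPa, Finset.sum_mul]
    refine Finset.sum_congr rfl fun i _ => ?_
    rw [Finset.sum_mul]
    refine Finset.sum_congr rfl fun j _ => ?_
    rw [mul_assoc _ (e i j) b, hcomm _ (he i j) b hb]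
    simp only [mul_assoc]
  · let _ := CStarAlgebra.spectralOrder A
    let _ := CStarAlgebra.spectralOrderedRing A
    refine CStarAlgebra.nonneg_iff_eq_star_mul_self.1 ?_
    rw [hPa]
    refine Finset.sum_nonneg fun i _ => Finset.sum_nonneg fun j _ => ?_
    convert star_mul_self_nonneg (a * e i j) using 1
    simp only [star_mul, hsa, mul_assoc]
  · rw [eq_top_iff]
    refine fun a _ => Submodule.le_topologicalClosure _ ?_
    rw [← hsum' a]
    refine sum_mem fun i _ => sum_mem fun j _ => sum_mem fun k _ => Submodule.subset_span ?_
    by_cases hjk : j = k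
    · subst hjk
      exact Or.inl (hcorner i j a)
    · exact Or.inr ⟨e i j, he i j, a, e i k, he i k, hort i j k hjk, rfl⟩
  · rw [eq_top_iff]
    refine fun a _ => StarSubalgebra.le_topologicalClosure _ ?_
    rw [← hsum' a]
    exact sum_mem fun i _ => sum_mem fun j _ => sum_mem fun k _ =>
      StarAlgebra.subset_adjoin ℂ _ (hN i j k a)
  · let _ := CStarAlgebra.spectralOrder A
    let _ := CStarAlgebra.spectralOrderedRing A
    have h0 : ∀ i j, 0 ≤ e i j * (star a * a) * e i j := fun i j => by
      convert star_mul_self_nonneg (a * e i j) using 1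
      simp only [star_mul, hsa, mul_assoc]
    rw [hPa, Finset.sum_eq_zero_iff_of_nonneg fun i _ => Finset.sum_nonneg fun j _ => h0 i j] at ha
    have h1 : ∀ i j, a * e i j = 0 := fun i j => by
      have := (Finset.sum_eq_zero_iff_of_nonneg fun j _ => h0 i j).1 (ha i (Finset.mem_univ i)) j
        (Finset.mem_univ j)
      rw [← CStarRing.star_mul_self_eq_zero_iff, ← this]
      simp only [star_mul, hsa, mul_assoc]
    rw [← hsum' a]
    refine Finset.sum_eq_zero fun i _ => Finset.sum_eq_zero fun j _ =>
      Finset.sum_eq_zero fun k _ => ?_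
    rw [mul_assoc, h1, mul_zero]

end Frame

/-! ### Minimal projections and spectral cutoffs -/

section Projections

open scoped Matrix.Norms.L2Operator

theorem card_eq_of_unitary {m n : Type*} [Fintype m] [DecidableEq m] [Fintype n] [DecidableEq n]
    {U : Matrix m n ℂ} (h1 : U * U.conjTranspose = 1) (h2 : U.conjTranspose * U = 1) :
    Fintype.card m = Fintype.card n := by
  have := Matrix.trace_mul_comm U U.conjTranspose
  rw [h1, h2, Matrix.trace_one, Matrix.trace_one] at this
  exact_mod_cast this

/-- If `M_r` contains `r` nonzero orthogonal idempotents, then they are minimal. -/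
theorem exists_smul_of_orthogonal_idempotents {m κ : Type*} [Fintype m] [DecidableEq m]
    [Fintype κ] [DecidableEq κ] (hcard : Fintype.card κ = Fintype.card m) {p : κ → Matrix m m ℂ}
    (h0 : ∀ j, p j ≠ 0) (hidem : ∀ j, p j * p j = p j) (hort : ∀ j k, j ≠ k → p j * p k = 0)
    (j : κ) (a : Matrix m m ℂ) : ∃ c : ℂ, p j * a * p j = c • p j := by
  have hw : ∀ j, ∃ w, (p j).mulVec w ≠ 0 := fun j => by
    by_contra! h
    exact h0 j (Matrix.ext_of_mulVec_single fun i => by rw [h, Matrix.zero_mulVec])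
  choose w hw using hw
  have hv : ∀ j, (p j).mulVec ((p j).mulVec (w j)) = (p j).mulVec (w j) := fun j => by
    rw [Matrix.mulVec_mulVec, hidem]
  have hv' : ∀ j k, j ≠ k → (p j).mulVec ((p k).mulVec (w k)) = 0 := fun j k hjk => by
    rw [Matrix.mulVec_mulVec, hort j k hjk, Matrix.zero_mulVec]
  have hsum : ∀ (c : κ → ℂ) j, (p j).mulVec (∑ k, c k • (p k).mulVec (w k)) =
      c j • (p j).mulVec (w j) := fun c j => by
    rw [Matrix.mulVec_sum, Finset.sum_eq_single j]
    · rw [Matrix.mulVec_smul, hv]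
    · intro k _ hk
      rw [Matrix.mulVec_smul, hv' j k hk.symm, smul_zero]
    · exact fun h => absurd (Finset.mem_univ j) h
  -- One nonzero vector from each range gives, by the count, a basis. Every `p j` then has rank one,
  -- which makes it minimal.
  have hli : LinearIndependent ℂ fun k => (p k).mulVec (w k) := by
    rw [Fintype.linearIndependent_iff]
    intro c hc k
    have := hsum c k
    rw [hc, Matrix.mulVec_zero] at this
    exact (smul_eq_zero.1 this.symm).resolve_right (hw k)
  have : Nonempty κ := ⟨j⟩
  let b := basisOfLinearIndependentOfCardEqFinrank hli (by rw [hcard, Module.finrank_pi])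
  have hb : ∀ k, b k = (p k).mulVec (w k) := fun k => by simp [b]
  refine ⟨b.repr (a.mulVec (b j)) j, ?_⟩
  refine Matrix.toLin'.injective (b.ext fun k => ?_)
  rw [Matrix.toLin'_apply, Matrix.toLin'_apply, Matrix.smul_mulVec, ← Matrix.mulVec_mulVec]
  by_cases hjk : j = k
  · subst hjk
    rw [hb, hv, ← hb, ← Matrix.mulVec_mulVec]
    conv_lhs => rw [← b.sum_repr (a.mulVec (b j))]
    simp only [hb]
    exact hsum _ j
  · rw [hb, hv' j k hjk, Matrix.mulVec_zero, smul_zero]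

/-- A continuous function that is `0` on `(-∞, 1/3]` and `1` on `[2/3, ∞)`. -/
def cutoff (t : ℝ) : ℝ := max 0 (min 1 (3 * t - 1))

theorem continuous_cutoff : Continuous cutoff := by
  unfold cutoff
  fun_prop

variable {A : Type*} [CStarAlgebra A]

/-- The value of `t - t²` at `1/3` and `2/3` is `2/9`, so the spectrum avoids the open interval
between them, and `cutoff` is `0` or `1` on what remains. -/
theorem cfc_cutoff_mul_self {b : A} (hb : IsSelfAdjoint b) (h : ‖b * b - b‖ < 2 / 9) :
    cfc cutoff b * cfc cutoff b = cfc cutoff b := by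
  have hc := continuous_cutoff
  rw [← cfc_mul cutoff cutoff b]
  refine cfc_congr fun t ht => ?_
  have h1 : b * b - b = cfc (fun t : ℝ => t * t - t) b := by
    rw [cfc_sub .., cfc_mul .., cfc_id' ℝ b]
  rw [h1] at h
  have h2 := (norm_apply_le_norm_cfc (fun t : ℝ => t * t - t) b ht).trans_lt h
  rw [Real.norm_eq_abs, abs_lt] at h2
  have h3 : t ≤ 1 / 3 ∨ 2 / 3 ≤ t := by
    by_contra! h3
    nlinarith
  simp only [cutoff]
  rcases h3 with h3 | h3
  · rw [min_eq_right (by linarith), max_eq_left (by linarith), mul_zero]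
  · rw [min_eq_left (by linarith), max_eq_right zero_le_one, mul_one]

theorem cfc_cutoff_eq_self {b : A} (hb : IsSelfAdjoint b) (h : b * b = b) :
    cfc cutoff b = b := by
  conv_rhs => rw [← cfc_id' ℝ b]
  refine cfc_congr fun t ht => ?_
  have h1 : cfc (fun t : ℝ => t * t - t) b = 0 := by
    rw [cfc_sub .., cfc_mul .., cfc_id' ℝ b, h, sub_self]
  have h2 := norm_apply_le_norm_cfc (fun t : ℝ => t * t - t) b ht
  rw [h1, norm_zero, norm_le_zero_iff] at h2
  have h3 : t = 0 ∨ t = 1 := by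
    rw [← sub_eq_zero (a := t) (b := 1), ← mul_eq_zero]
    linarith
  rcases h3 with rfl | rfl <;> norm_num [cutoff]

/-- Upgrades approximate relations between commuting projections to exact ones. -/
theorem eq_zero_of_projection {q : A} (hsa : star q = q) (hq : q * q = q) (hn : ‖q‖ < 1) :
    q = 0 := by
  have h := CStarRing.norm_star_mul_self (x := q)
  rw [hsa, hq] at h
  by_contra hq0
  have : 0 < ‖q‖ := norm_pos_iff.2 hq0
  nlinarith

end Projections

/-! ### Fibrewise diagonal subalgebras of matrix fields -/

section Field

open scoped Matrix.Norms.L2Operator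

/-- The representations `ρ x` present `A` as the algebra of a continuous field of matrix algebras
over `X`. -/
structure IsMatrixField {A : Type*} [CStarAlgebra A] {X : Type*} [TopologicalSpace X]
    {r : X → ℕ} (ρ : ∀ x, A →⋆ₐ[ℂ] Matrix (Fin (r x)) (Fin (r x)) ℂ) : Prop where
  ext : ∀ a b, (∀ x, ρ x a = ρ x b) → a = b
  continuous_norm : ∀ a, Continuous fun x => ‖ρ x a‖
  exists_central : ∀ h : C(X, ℝ), ∃ c : A, ∀ x, ρ x c = (h x : ℂ) • 1
  eventually_rank : ∀ x₀, ∀ᶠ x in 𝓝 x₀, r x = r x₀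

/-- `B` is its own commutant, and it contains the diagonal matrices with respect to some
orthonormal basis in every fibre. -/
structure IsFieldDiagonal {A : Type*} [CStarAlgebra A] {X : Type*}
    {r : X → ℕ} (ρ : ∀ x, A →⋆ₐ[ℂ] Matrix (Fin (r x)) (Fin (r x)) ℂ)
    (B : StarSubalgebra ℂ A) : Prop where
  mem_iff : ∀ a, a ∈ B ↔ ∀ b ∈ B, b * a = a * b
  exists_diagonal : ∀ x, ∃ (κ : Type) (_ : Fintype κ) (_ : DecidableEq κ)
    (U : Matrix (Fin (r x)) κ ℂ), U * U.conjTranspose = 1 ∧ U.conjTranspose * U = 1 ∧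
    ∀ d : κ → ℂ, ∃ b ∈ B, ρ x b = U * Matrix.diagonal d * U.conjTranspose

variable {A : Type*} [CStarAlgebra A] {X : Type*} [TopologicalSpace X]
  {r : X → ℕ} {ρ : ∀ x, A →⋆ₐ[ℂ] Matrix (Fin (r x)) (Fin (r x)) ℂ} {B : StarSubalgebra ℂ A}

/-- The minimal diagonal projections at `x₀` lift to `B`. Near `x₀` norm continuity keeps them
nonzero projections, orthogonal and with sum `1`. Their number is the locally constant rank, so they
remain minimal. -/
theorem IsFieldDiagonal.exists_local_projections (hB : IsFieldDiagonal ρ B)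
    (hρ : IsMatrixField ρ) (x₀ : X) :
    ∃ (κ : Type) (_ : Fintype κ) (p : κ → A), (∀ j, p j ∈ B) ∧ (∀ j, star (p j) = p j) ∧
      ∀ᶠ x in 𝓝 x₀, (∀ j k, j ≠ k → ρ x (p j) * ρ x (p k) = 0) ∧ ∑ j, ρ x (p j) = 1 ∧
        ∀ j m, ∃ c : ℂ, ρ x (p j) * m * ρ x (p j) = c • ρ x (p j) := by
  obtain ⟨κ, _, _, U, hU, hU', hd⟩ := hB.exists_diagonal x₀
  have hcomm : ∀ x ∈ B, ∀ y ∈ B, x * y = y * x := fun x hx y hy => (hB.mem_iff y).1 hy x hx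
  choose b hb hρb using fun j => hd (Pi.single j 1)
  have hmul : ∀ d e : κ → ℂ, (U * Matrix.diagonal d * U.conjTranspose) *
      (U * Matrix.diagonal e * U.conjTranspose) = U * Matrix.diagonal (d * e) * U.conjTranspose :=
    fun d e => by
      calc _ = U * Matrix.diagonal d * (U.conjTranspose * U) * Matrix.diagonal e *
            U.conjTranspose := by simp only [Matrix.mul_assoc]
        _ = _ := by
          rw [hU', Matrix.mul_one, Matrix.mul_assoc U, Matrix.diagonal_mul_diagonal]
          rfl
  have hρb' : ∀ j, ρ x₀ (star (b j) * b j) =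
      U * Matrix.diagonal (Pi.single j (1 : ℂ)) * U.conjTranspose := fun j => by
    rw [map_mul, map_star, hρb]
    have : star (U * Matrix.diagonal (Pi.single j (1 : ℂ)) * U.conjTranspose) =
        U * Matrix.diagonal (Pi.single j (1 : ℂ)) * U.conjTranspose := by
      rw [Matrix.star_eq_conjTranspose, Matrix.conjTranspose_mul, Matrix.conjTranspose_mul,
        Matrix.conjTranspose_conjTranspose, Matrix.diagonal_conjTranspose, ← Matrix.mul_assoc]
      simp [Pi.star_single]
    rw [this, hmul, ← Pi.single_mul, one_mul]
  have hcl := isClosed_of_mem_iff_commute hB.mem_iff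
  have hsa : ∀ j, IsSelfAdjoint (star (b j) * b j) := fun j => IsSelfAdjoint.star_mul_self _
  -- `p j` is globally defined and in `B`, but a projection only in fibres near `x₀`. The value at
  -- `x₀` is already a projection, so the cutoff does not change it.
  let p : κ → A := fun j => cfc cutoff (star (b j) * b j)
  have hpB : ∀ j, p j ∈ B := fun j => cfc_mem (hs := hcl) _ (mul_mem (star_mem (hb j)) (hb j))
  have hps : ∀ j, star (p j) = p j := fun j => cfc_predicate cutoff (star (b j) * b j)
  have hρp : ∀ x j, ρ x (p j) = cfc cutoff (ρ x (star (b j) * b j)) := fun x j =>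
    StarAlgHomClass.map_cfc (ρ x) cutoff _ (hf := continuous_cutoff.continuousOn)
      (hφ := (ρ x).continuous_of_cstar) (ha := hsa j) (hφa := (hsa j).map _)
  have hp0 : ∀ j, ρ x₀ (p j) = U * Matrix.diagonal (Pi.single j (1 : ℂ)) * U.conjTranspose := fun j => by
    rw [hρp, cfc_cutoff_eq_self ((hsa j).map _), hρb']
    rw [hρb', hmul, ← Pi.single_mul, one_mul]
  refine ⟨κ, inferInstance, p, hpB, hps, ?_⟩
  have hev : ∀ a ε, ‖ρ x₀ a‖ < ε → ∀ᶠ x in 𝓝 x₀, ‖ρ x a‖ < ε := fun a ε h =>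
    (hρ.continuous_norm a).continuousAt.eventually_lt_const h
  have ev1 : ∀ j, ∀ᶠ x in 𝓝 x₀, ρ x (p j) * ρ x (p j) = ρ x (p j) := fun j => by
    filter_upwards [hev ((star (b j) * b j) * (star (b j) * b j) - star (b j) * b j) (2 / 9) (by
      rw [map_sub, map_mul _ (star (b j) * b j), hρb', hmul, ← Pi.single_mul, one_mul, sub_self,
        norm_zero]
      norm_num)] with x hx
    rw [map_sub, map_mul _ (star (b j) * b j)] at hx
    rw [hρp, cfc_cutoff_mul_self ((hsa j).map _) hx]
  have ev2 : ∀ j k, ∀ᶠ x in 𝓝 x₀, j ≠ k → ‖ρ x (p j * p k)‖ < 1 := fun j k => by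
    by_cases hjk : j = k
    · exact Eventually.of_forall fun x h => absurd hjk h
    · filter_upwards [hev (p j * p k) 1 (by
        have : (Pi.single j 1 * Pi.single k 1 : κ → ℂ) = 0 := by
          ext i
          by_cases hi : i = j
          · subst hi
            simp [hjk]
          · simp [hi]
        rw [map_mul, hp0, hp0, hmul, this]
        simp)] with x hx _ using hx
  have ev3 : ∀ᶠ x in 𝓝 x₀, ‖ρ x (1 - ∑ j, p j)‖ < 1 := by
    refine hev _ _ ?_
    have : ρ x₀ (∑ j, p j) = 1 := by
      simp only [map_sum, hp0]
      rw [← Matrix.sum_mul, ← Matrix.mul_sum]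
      have : ∑ j, Matrix.diagonal (Pi.single j (1 : ℂ)) = (1 : Matrix κ κ ℂ) := by
        have h := map_sum (Matrix.diagonalAddMonoidHom κ ℂ) (fun j => Pi.single j (1 : ℂ))
          Finset.univ
        rw [Finset.univ_sum_single (fun _ => (1 : ℂ))] at h
        exact h.symm.trans Matrix.diagonal_one
      rw [this, Matrix.mul_one, hU]
    rw [map_sub, map_one, this, sub_self, norm_zero]
    exact one_pos
  have ev4 : ∀ j, ∀ᶠ x in 𝓝 x₀, ρ x (p j) ≠ 0 := fun j => by
    have h0 : ρ x₀ (p j) ≠ 0 := fun h => by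
      rw [hp0] at h
      have h1 : U.conjTranspose * (U * Matrix.diagonal (Pi.single j (1 : ℂ)) * U.conjTranspose) * U
          = Matrix.diagonal (Pi.single j (1 : ℂ)) := by
        calc _ = (U.conjTranspose * U) * Matrix.diagonal (Pi.single j (1 : ℂ)) *
              (U.conjTranspose * U) := by simp only [Matrix.mul_assoc]
          _ = _ := by rw [hU', Matrix.one_mul, Matrix.mul_one]
      rw [h, Matrix.mul_zero, Matrix.zero_mul] at h1
      have := congrFun (congrFun h1 j) j
      simp at this
    filter_upwards [(hρ.continuous_norm (p j)).continuousAt.eventually_const_lt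
      (norm_pos_iff.2 h0)] with x hx
    exact norm_pos_iff.1 hx
  filter_upwards [eventually_all.2 ev1, eventually_all.2 fun j => eventually_all.2 (ev2 j), ev3,
    eventually_all.2 ev4, hρ.eventually_rank x₀] with x h1 h2 h3 h4 h5
  have hsx : ∀ j, star (ρ x (p j)) = ρ x (p j) := fun j => by rw [← map_star, hps]
  have hcx : ∀ j k, ρ x (p j) * ρ x (p k) = ρ x (p k) * ρ x (p j) := fun j k => by
    rw [← map_mul, hcomm _ (hpB j) _ (hpB k), map_mul]
  have hort : ∀ j k, j ≠ k → ρ x (p j) * ρ x (p k) = 0 := fun j k hjk => by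
    refine eq_zero_of_projection (by rw [star_mul, hsx, hsx, hcx]) ?_ (map_mul (ρ x) _ _ ▸ h2 j k hjk)
    calc ρ x (p j) * ρ x (p k) * (ρ x (p j) * ρ x (p k))
        = ρ x (p j) * (ρ x (p k) * ρ x (p j)) * ρ x (p k) := by simp only [mul_assoc]
      _ = (ρ x (p j) * ρ x (p j)) * (ρ x (p k) * ρ x (p k)) := by
          rw [hcx k j]; simp only [mul_assoc]
      _ = _ := by rw [h1, h1]
  refine ⟨hort, ?_, fun j m => exists_smul_of_orthogonal_idempotents ?_ h4 h1 hort j m⟩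
  · rw [map_sub, map_one, map_sum] at h3
    have hs : (∑ j, ρ x (p j)) * (∑ j, ρ x (p j)) = ∑ j, ρ x (p j) := by
      rw [Finset.sum_mul]
      refine Finset.sum_congr rfl fun j _ => ?_
      rw [Finset.mul_sum, Finset.sum_eq_single j]
      · exact h1 j
      · exact fun k _ hk => hort j k hk.symm
      · exact fun h => absurd (Finset.mem_univ j) h
    refine (sub_eq_zero.1 (eq_zero_of_projection ?_ ?_ h3)).symm
    · rw [star_sub, star_one, star_sum]
      simp only [hsx]
    · rw [sub_mul, mul_sub, mul_sub, hs]
      simp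
  · rw [Fintype.card_fin, h5, ← card_eq_of_unitary hU hU', Fintype.card_fin]

theorem IsFieldDiagonal.exists_isDiagonalPair [CompactSpace X] [T2Space X]
    (hB : IsFieldDiagonal ρ B) (hρ : IsMatrixField ρ) : ∃ P, IsDiagonalPair B P := by
  have hcomm : ∀ x ∈ B, ∀ y ∈ B, x * y = y * x := fun x hx y hy => (hB.mem_iff y).1 hy x hx
  choose κ hκ p hpB hps hev using fun x₀ => hB.exists_local_projections hρ x₀
  choose V hVsub hVo hVx using fun x₀ => eventually_nhds_iff.1 (hev x₀)
  obtain ⟨t, ht⟩ := isCompact_univ.elim_finite_subcover V hVo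
    fun x _ => Set.mem_iUnion.2 ⟨x, hVx x⟩
  obtain ⟨f, hf⟩ := PartitionOfUnity.exists_isSubordinate isClosed_univ (fun i : t => V i)
    (fun i => hVo i) (by simpa [Set.iUnion_subtype] using ht)
  -- Square roots, because frame elements enter on both sides and the products must sum to `1`.
  have hcent : ∀ i : t, ∃ c : A, ∀ x, ρ x c = ((√(f i x) : ℝ) : ℂ) • 1 := fun i =>
    hρ.exists_central ⟨fun x => √(f i x), by fun_prop⟩
  choose g hg using hcent
  have hgc : ∀ i a, g i * a = a * g i := fun i a => hρ.ext _ _ fun x => by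
    rw [map_mul, map_mul, hg, smul_mul_assoc, mul_smul_comm, one_mul, mul_one]
  have hgs : ∀ i, star (g i) = g i := fun i => hρ.ext _ _ fun x => by
    rw [map_star, hg, star_smul, star_one, Complex.star_def, Complex.conj_ofReal]
  have hgB : ∀ i, g i ∈ B := fun i => (hB.mem_iff _).2 fun b _ => (hgc i b).symm
  have hzero : ∀ (i : t) x, x ∉ V i → f i x = 0 := fun i x hx => by
    by_contra h
    exact hx (hf i (subset_tsupport _ h))
  have hρe : ∀ x (i : t) j, ρ x (g i * p i j) = ((√(f i x) : ℝ) : ℂ) • ρ x (p i j) :=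
    fun x i j => by rw [map_mul, hg, smul_mul_assoc, one_mul]
  refine exists_isDiagonalPair_of_frame hB.mem_iff (I := t) (J := fun i => κ i)
    (fun i j => g i * p i j) (fun i j => mul_mem (hgB i) (hpB i j)) (fun i j => ?_)
    (fun i j a => ?_) (fun i j k hjk => ?_) fun a => ?_
  · rw [star_mul, hps, hgs, hgc]
  -- By minimality a corner is, in each fibre, a scalar multiple of `p i j` (or zero), so it
  -- commutes with `B` and lies in it.
  · refine (hB.mem_iff _).2 fun b hb => hρ.ext _ _ fun x => ?_
    rw [map_mul, map_mul (ρ x) _ b, map_mul, map_mul, hρe]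
    by_cases hx : x ∈ V i
    · obtain ⟨c, hc⟩ := (hVsub i x hx).2.2 j (ρ x a)
      simp only [smul_mul_assoc, mul_smul_comm, hc]
      rw [← map_mul, hcomm b hb _ (hpB i j), map_mul]
    · simp [hzero i x hx]
  · refine hρ.ext _ _ fun x => ?_
    rw [map_mul, hρe, hρe, map_zero]
    by_cases hx : x ∈ V i
    · simp only [smul_mul_assoc, mul_smul_comm, (hVsub i x hx).1 j k hjk, smul_zero]
    · simp [hzero i x hx]
  · refine hρ.ext _ _ fun x => ?_
    rw [map_sum]
    have h1 : ∀ i : t, ρ x ((∑ j, g i * p i j) * a * ∑ k, g i * p i k) =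
        ((f i x : ℝ) : ℂ) • ρ x a := fun i => by
      rw [map_mul, map_mul, map_sum]
      simp only [hρe]
      rw [← Finset.smul_sum]
      by_cases hx : x ∈ V i
      · rw [(hVsub i x hx).2.1, smul_mul_assoc, one_mul, smul_mul_assoc, mul_smul_comm, mul_one,
          smul_smul, ← Complex.ofReal_mul, Real.mul_self_sqrt (f.nonneg i x)]
      · simp [hzero i x hx]
    rw [Finset.sum_congr rfl fun i _ => h1 i, ← Finset.sum_smul, ← Complex.ofReal_sum]
    have h2 := f.sum_eq_one (Set.mem_univ x)
    rw [finsum_eq_sum_of_fintype] at h2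
    rw [h2, Complex.ofReal_one, one_smul]

end Field

/-! ### Transfer along multiplicity free homomorphisms -/

section Transfer

open scoped Matrix.Norms.L2Operator

theorem exists_eq_diagonal_of_commute {m κ : Type*} [Fintype m] [DecidableEq m] [Fintype κ]
    [DecidableEq κ] {U : Matrix m κ ℂ} (h1 : U * U.conjTranspose = 1)
    (h2 : U.conjTranspose * U = 1) {M : Matrix m m ℂ}
    (hM : ∀ d : κ → ℂ, (U * Matrix.diagonal d * U.conjTranspose) * M =
      M * (U * Matrix.diagonal d * U.conjTranspose)) :
    ∃ d : κ → ℂ, M = U * Matrix.diagonal d * U.conjTranspose := by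
  obtain ⟨N, hN⟩ : ∃ N, N = U.conjTranspose * M * U := ⟨_, rfl⟩
  have hMN : M = U * N * U.conjTranspose := by
    calc M = (U * U.conjTranspose) * M * (U * U.conjTranspose) := by
          rw [h1, Matrix.one_mul, Matrix.mul_one]
      _ = _ := by rw [hN]; simp only [Matrix.mul_assoc]
  have hcomm : ∀ d : κ → ℂ, Matrix.diagonal d * N = N * Matrix.diagonal d := fun d => by
    calc Matrix.diagonal d * N
        = (U.conjTranspose * U) * Matrix.diagonal d * U.conjTranspose * M * U := by
          rw [h2, Matrix.one_mul, hN]; simp only [Matrix.mul_assoc]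
      _ = U.conjTranspose * ((U * Matrix.diagonal d * U.conjTranspose) * M) * U := by
          simp only [Matrix.mul_assoc]
      _ = U.conjTranspose * M * U * Matrix.diagonal d * (U.conjTranspose * U) := by
          rw [hM]; simp only [Matrix.mul_assoc]
      _ = N * Matrix.diagonal d := by rw [h2, Matrix.mul_one, hN]
  refine ⟨fun k => N k k, ?_⟩
  rw [hMN]
  congr 2
  ext j k
  by_cases hjk : j = k
  · subst hjk
    simp
  · have := congrFun (congrFun (hcomm (Pi.single j (1 : ℂ))) j) k
    rw [Matrix.diagonal_mul, Matrix.mul_diagonal] at this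
    rw [Matrix.diagonal_apply_ne _ hjk]
    simpa [hjk, Ne.symm hjk] using this

theorem exists_continuous_eq_ite {X : Type*} [TopologicalSpace X] [CompactSpace X] [T2Space X]
    {m : ℕ} {x : Fin m → X} (hx : Function.Injective x) (μ : Fin m) :
    ∃ h : C(X, ℝ), ∀ ν, h (x ν) = if ν = μ then 1 else 0 := by
  obtain ⟨h, h0, h1, -⟩ := exists_continuous_zero_one_of_isClosed
    (s := x '' {ν | ν ≠ μ}) (t := {x μ}) (Set.toFinite _).isClosed isClosed_singleton (by
      rw [Set.disjoint_singleton_right]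
      rintro ⟨ν, hν, h⟩
      exact hν (hx h))
  refine ⟨h, fun ν => ?_⟩
  split_ifs with hν
  · rw [hν]
    exact h1 rfl
  · exact h0 ⟨ν, hν, rfl⟩

variable {A : Type*} [CStarAlgebra A] {X : Type*} [TopologicalSpace X]
  {r : X → ℕ} {ρ : ∀ x, A →⋆ₐ[ℂ] Matrix (Fin (r x)) (Fin (r x)) ℂ} {B : StarSubalgebra ℂ A}
  {A' : Type*} [CStarAlgebra A'] {X' : Type*}
  {r' : X' → ℕ} {ρ' : ∀ x, A' →⋆ₐ[ℂ] Matrix (Fin (r' x)) (Fin (r' x)) ℂ}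

/-- A *-homomorphism between matrix fields that is, at every point, a direct sum of evaluations
at distinct points. -/
def IsMultiplicityFree (ρ : ∀ x, A →⋆ₐ[ℂ] Matrix (Fin (r x)) (Fin (r x)) ℂ)
    (ρ' : ∀ x, A' →⋆ₐ[ℂ] Matrix (Fin (r' x)) (Fin (r' x)) ℂ) (φ : A →⋆ₐ[ℂ] A') : Prop :=
  ∀ y, ∃ (m : ℕ) (x : Fin m → X) (U : Matrix (Fin (r' y)) (Σ μ : Fin m, Fin (r (x μ))) ℂ),
    Function.Injective x ∧ U * U.conjTranspose = 1 ∧ U.conjTranspose * U = 1 ∧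
    ∀ a, ρ' y (φ a) = U * Matrix.blockDiagonal' (fun μ => ρ (x μ) a) * U.conjTranspose

/-- The image of a field diagonal under a multiplicity free homomorphism contains the diagonal
matrices of some orthonormal basis in every fibre. -/
theorem IsFieldDiagonal.exists_diagonal_map [CompactSpace X] [T2Space X]
    (hB : IsFieldDiagonal ρ B) (hρ : IsMatrixField ρ) {φ : A →⋆ₐ[ℂ] A'}
    (hφ : IsMultiplicityFree ρ ρ' φ) (y : X') :
    ∃ (κ : Type) (_ : Fintype κ) (_ : DecidableEq κ)
      (W : Matrix (Fin (r' y)) κ ℂ), W * W.conjTranspose = 1 ∧ W.conjTranspose * W = 1 ∧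
      ∀ d : κ → ℂ, ∃ b ∈ B, ρ' y (φ b) = W * Matrix.diagonal d * W.conjTranspose := by
  obtain ⟨m, x, U, hx, hU, hU', hφy⟩ := hφ y
  choose κ hκ hκ' V hV hV' hd using fun μ => hB.exists_diagonal (x μ)
  -- Distinctness of the points is used here: the central elements `c μ` let the values of `B` at
  -- the various `x μ` be prescribed independently.
  choose h hh using fun μ => exists_continuous_eq_ite hx μ
  choose c hc using fun μ => hρ.exists_central (h μ)
  have hcB : ∀ μ, c μ ∈ B := fun μ => (hB.mem_iff _).2 fun b _ => hρ.ext _ _ fun z => by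
    rw [map_mul, map_mul, hc, mul_smul_comm, smul_mul_assoc, one_mul, mul_one]
  have hD1 : Matrix.blockDiagonal' V * (Matrix.blockDiagonal' V).conjTranspose = 1 := by
    rw [Matrix.blockDiagonal'_conjTranspose, ← Matrix.blockDiagonal'_mul,
      ← Matrix.blockDiagonal'_one]
    exact congrArg _ (funext hV)
  have hD2 : (Matrix.blockDiagonal' V).conjTranspose * Matrix.blockDiagonal' V = 1 := by
    rw [Matrix.blockDiagonal'_conjTranspose, ← Matrix.blockDiagonal'_mul,
      ← Matrix.blockDiagonal'_one]
    exact congrArg _ (funext hV')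
  refine ⟨Σ μ, κ μ, inferInstance, inferInstance, U * Matrix.blockDiagonal' V, ?_, ?_, fun d => ?_⟩
  · rw [Matrix.conjTranspose_mul]
    calc _ = U * (Matrix.blockDiagonal' V * (Matrix.blockDiagonal' V).conjTranspose) *
          U.conjTranspose := by simp only [Matrix.mul_assoc]
      _ = 1 := by rw [hD1, Matrix.mul_one, hU]
  · rw [Matrix.conjTranspose_mul]
    calc _ = (Matrix.blockDiagonal' V).conjTranspose * (U.conjTranspose * U) *
          Matrix.blockDiagonal' V := by simp only [Matrix.mul_assoc]
      _ = 1 := by rw [hU', Matrix.mul_one, hD2]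
  · choose b hb hρb using fun μ => hd μ fun k => d ⟨μ, k⟩
    refine ⟨∑ μ, c μ * b μ, sum_mem fun μ _ => mul_mem (hcB μ) (hb μ), ?_⟩
    have h1 : ∀ ν, ρ (x ν) (∑ μ, c μ * b μ) =
        V ν * Matrix.diagonal (fun k => d ⟨ν, k⟩) * (V ν).conjTranspose := fun ν => by
      rw [map_sum, Finset.sum_eq_single ν]
      · rw [map_mul, hc, hh, if_pos rfl, hρb, Complex.ofReal_one, one_smul, one_mul]
      · intro μ _ hμ
        rw [map_mul, hc, hh, if_neg hμ.symm, Complex.ofReal_zero, zero_smul, zero_mul]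
      · exact fun h => absurd (Finset.mem_univ ν) h
    rw [hφy, funext h1, Matrix.blockDiagonal'_mul, Matrix.blockDiagonal'_mul,
      Matrix.blockDiagonal'_diagonal, ← Matrix.blockDiagonal'_conjTranspose,
      Matrix.conjTranspose_mul]
    simp only [Matrix.mul_assoc]

theorem mem_centralizer_image_iff {φ : A →⋆ₐ[ℂ] A'} {a : A'} :
    a ∈ StarSubalgebra.centralizer ℂ (φ '' B) ↔ ∀ b ∈ B, φ b * a = a * φ b := by
  rw [StarSubalgebra.mem_centralizer_iff]
  refine ⟨fun h b hb => (h _ ⟨b, hb, rfl⟩).1, ?_⟩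
  rintro h _ ⟨b, hb, rfl⟩
  refine ⟨h b hb, ?_⟩
  rw [← map_star]
  exact h _ (star_mem hb)

theorem IsFieldDiagonal.map_mem_centralizer {X : Type*} {r : X → ℕ}
    {ρ : ∀ x, A →⋆ₐ[ℂ] Matrix (Fin (r x)) (Fin (r x)) ℂ} (hB : IsFieldDiagonal ρ B) (φ : A →⋆ₐ[ℂ] A') {b : A}
    (hb : b ∈ B) : φ b ∈ StarSubalgebra.centralizer ℂ (φ '' B) := by
  rw [mem_centralizer_image_iff]
  intro c hc
  rw [← map_mul, (hB.mem_iff b).1 hb c hc, map_mul]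

variable [CompactSpace X] [T2Space X]

/-- In the fibre at `y` the image of `φ(B)` contains a full diagonal algebra, which is its own
commutant. The element `b` depends on `y`, so the commutant can still exceed `φ(B)` globally. -/
theorem IsFieldDiagonal.exists_mem_map_eq (hB : IsFieldDiagonal ρ B) (hρ : IsMatrixField ρ)
    {φ : A →⋆ₐ[ℂ] A'} (hφ : IsMultiplicityFree ρ ρ' φ) {a : A'}
    (ha : a ∈ StarSubalgebra.centralizer ℂ (φ '' B)) (y : X') :
    ∃ b ∈ B, ρ' y a = ρ' y (φ b) := by
  rw [mem_centralizer_image_iff] at ha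
  obtain ⟨κ, _, _, W, hW, hW', hd⟩ := hB.exists_diagonal_map hρ hφ y
  obtain ⟨d, hd'⟩ := exists_eq_diagonal_of_commute hW hW' (M := ρ' y a) fun d => by
    obtain ⟨b, hb, hbd⟩ := hd d
    rw [← hbd, ← map_mul, ha b hb, map_mul]
  obtain ⟨b, hb, hbd⟩ := hd d
  exact ⟨b, hb, hd'.trans hbd.symm⟩

variable [TopologicalSpace X']

/-- Fibrewise the commutant takes values of `φ(B)`, so it is abelian. It contains `φ(B)`, so
whatever commutes with it already belongs to it. -/
theorem IsFieldDiagonal.centralizer (hB : IsFieldDiagonal ρ B) (hρ : IsMatrixField ρ)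
    (hρ' : IsMatrixField ρ') {φ : A →⋆ₐ[ℂ] A'} (hφ : IsMultiplicityFree ρ ρ' φ) :
    IsFieldDiagonal ρ' (StarSubalgebra.centralizer ℂ (φ '' B)) := by
  refine ⟨fun a => ⟨fun ha b hb => hρ'.ext _ _ fun y => ?_, fun h => ?_⟩, fun y => ?_⟩
  · obtain ⟨a', ha', h1⟩ := hB.exists_mem_map_eq hρ hφ ha y
    obtain ⟨b', hb', h2⟩ := hB.exists_mem_map_eq hρ hφ hb y
    rw [map_mul, map_mul, h1, h2, ← map_mul, ← map_mul, ← map_mul, ← map_mul,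
      (hB.mem_iff a').1 ha' b' hb']
  · exact mem_centralizer_image_iff.2 fun b hb => h _ (hB.map_mem_centralizer φ hb)
  · obtain ⟨κ, _, _, W, hW, hW', hd⟩ := hB.exists_diagonal_map hρ hφ y
    refine ⟨κ, _, _, W, hW, hW', fun d => ?_⟩
    obtain ⟨b, hb, h⟩ := hd d
    exact ⟨φ b, hB.map_mem_centralizer φ hb, h⟩

/-- In one fibre `b` may be replaced by `φ b'` with `b' ∈ B`, and then `n * b' * star n ∈ B` gives
the commutation. -/
theorem IsFieldDiagonal.map_mem_normalizers (hB : IsFieldDiagonal ρ B) (hρ : IsMatrixField ρ)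
    (hρ' : IsMatrixField ρ') {φ : A →⋆ₐ[ℂ] A'} (hφ : IsMultiplicityFree ρ ρ' φ) {n : A}
    (hn : n ∈ normalizers B) : φ n ∈ normalizers (StarSubalgebra.centralizer ℂ (φ '' B)) := by
  have key : ∀ n : A, (∀ b ∈ B, n * b * star n ∈ B) →
      ∀ b ∈ StarSubalgebra.centralizer ℂ (φ '' B),
        φ n * b * star (φ n) ∈ StarSubalgebra.centralizer ℂ (φ '' B) := fun n hn b hb => by
    refine mem_centralizer_image_iff.2 fun c hc => hρ'.ext _ _ fun y => ?_
    obtain ⟨b', hb', h⟩ := hB.exists_mem_map_eq hρ hφ hb y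
    have h1 : ρ' y (φ n * b * star (φ n)) = ρ' y (φ (n * b' * star n)) := by
      simp only [map_mul, map_star, h]
    rw [map_mul, map_mul _ _ (φ c), h1, ← map_mul, ← map_mul, ← map_mul, ← map_mul,
      (hB.mem_iff _).1 (hn b' hb') c hc]
  refine fun b hb => ⟨key n (fun b hb => (hn b hb).1) b hb, ?_⟩
  have := key (star n) (fun b hb => by rw [star_star]; exact (hn b hb).2) b hb
  rwa [map_star, star_star] at this

end Transfer

/-! ### Maximal abelian subalgebras are their own commutants -/

section MaximalAbelian

theorem realPart_mem {A : Type*} [CStarAlgebra A] {B : StarSubalgebra ℂ A} {a : A} (ha : a ∈ B) :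
    (realPart a : A) ∈ B := by
  rw [realPart_apply_coe, ← Complex.coe_smul]
  exact B.smul_mem (add_mem ha (star_mem ha)) _

theorem imaginaryPart_mem {A : Type*} [CStarAlgebra A] {B : StarSubalgebra ℂ A} {a : A}
    (ha : a ∈ B) : (imaginaryPart a : A) ∈ B := by
  rw [imaginaryPart_apply_coe, ← Complex.coe_smul]
  exact B.smul_mem (B.smul_mem (sub_mem ha (star_mem ha)) _) _

theorem IsCartanSubalgebra.mem_iff_commute {A : Type u} [CStarAlgebra A] {B : StarSubalgebra ℂ A}
    (hB : IsCartanSubalgebra B) (a : A) : a ∈ B ↔ ∀ b ∈ B, b * a = a * b := by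
  refine ⟨fun ha b hb => hB.maximal_abelian.prop b hb a ha, fun ha => ?_⟩
  -- For self-adjoint `c`, the set `B ∪ {c}` is commuting and star-closed, so it generates an
  -- abelian *-subalgebra. The general case follows from real and imaginary parts.
  have key : ∀ c, IsSelfAdjoint c → (∀ b ∈ B, b * c = c * b) → c ∈ B := fun c hc h => by
    have hs : ∀ x ∈ insert c (B : Set A), ∀ y ∈ insert c (B : Set A), x * y = y * x := by
      rintro x (rfl | hx) y (rfl | hy)
      exacts [rfl, (h y hy).symm, h x hx, hB.maximal_abelian.prop x hx y hy]
    have hs' : ∀ x ∈ insert c (B : Set A), star x ∈ insert c (B : Set A) := by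
      rintro x (rfl | hx)
      exacts [Or.inl hc, Or.inr (star_mem hx)]
    have hm := StarAlgebra.isMulCommutative_adjoin ℂ hs fun x hx y hy => hs x hx _ (hs' y hy)
    have hle : B ≤ StarAlgebra.adjoin ℂ (insert c (B : Set A)) := fun b hb =>
      StarAlgebra.subset_adjoin ℂ _ (Or.inr hb)
    refine hB.maximal_abelian.le_of_ge (fun x hx y hy => ?_) hle
      (StarAlgebra.subset_adjoin ℂ _ (Or.inl rfl))
    exact congrArg Subtype.val (hm.is_comm.comm (⟨x, hx⟩ : StarAlgebra.adjoin ℂ _) ⟨y, hy⟩)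
  have hstar : ∀ b ∈ B, b * star a = star a * b := fun b hb => by
    have := congrArg star (ha (star b) (star_mem hb))
    simpa using this.symm
  rw [← realPart_add_I_smul_imaginaryPart a]
  refine add_mem (key _ (realPart a).2 fun b hb => ?_)
    (B.smul_mem (key _ (imaginaryPart a).2 fun b hb => ?_) _)
  · rw [realPart_apply_coe, mul_smul_comm, smul_mul_assoc, mul_add, add_mul, ha b hb, hstar b hb]
  · rw [imaginaryPart_apply_coe, mul_smul_comm, smul_mul_assoc, mul_smul_comm, smul_mul_assoc,
      mul_sub, sub_mul, ha b hb, hstar b hb]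

end MaximalAbelian

/-! ### Unique extension and common eigenvectors -/

section Base

variable {E : Type*} [NormedAddCommGroup E] [InnerProductSpace ℂ E] [FiniteDimensional ℂ E]
  {A : Type u} [CStarAlgebra A]

open scoped ComplexOrder

/-- The vector state of a unit vector. -/
def vectorState (Θ : A →⋆ₐ[ℂ] (E →L[ℂ] E)) (v : E) : A →ₗ[ℂ] ℂ where
  toFun a := inner ℂ v (Θ a v)
  map_add' a b := by simp
  map_smul' c a := by simp

theorem vectorState_apply (Θ : A →⋆ₐ[ℂ] (E →L[ℂ] E)) (v : E) (a : A) :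
    vectorState Θ v a = inner ℂ v (Θ a v) := rfl

theorem isState_vectorState (Θ : A →⋆ₐ[ℂ] (E →L[ℂ] E)) {v : E} (hv : ‖v‖ = 1) :
    IsState (vectorState Θ v) := by
  refine ⟨fun a => ?_, ?_⟩
  · rw [vectorState_apply, map_mul, map_star, ContinuousLinearMap.star_eq_adjoint,
      mul_apply_eq_comp, ContinuousLinearMap.adjoint_inner_right,
      inner_self_eq_norm_sq_to_K]
    exact Complex.zero_le_real.2 (sq_nonneg ‖Θ a v‖) |>.trans_eq (Complex.ofReal_pow _ _)
  · rw [vectorState_apply, map_one, one_apply_eq_self, inner_self_eq_norm_sq_to_K, hv]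
    simp

theorem span_common_eigenvectors (Θ : A →⋆ₐ[ℂ] (E →L[ℂ] E)) {B : StarSubalgebra ℂ A}
    (hc : ∀ x ∈ B, ∀ y ∈ B, x * y = y * x) :
    Submodule.span ℂ {v : E | ∀ b ∈ B, ∃ c : ℂ, Θ b v = c • v} = ⊤ := by
  let T : {b : A // b ∈ B ∧ IsSelfAdjoint b} → E →ₗ[ℂ] E := fun b => (Θ b : E →ₗ[ℂ] E)
  have hT : ∀ b, (T b).IsSymmetric := fun b =>
    ContinuousLinearMap.isSelfAdjoint_iff_isSymmetric.1 (b.2.2.map Θ)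
  have hcomm : Pairwise (Function.onFun Commute T) := fun b c _ => by
    have : Θ b * Θ c = Θ c * Θ b := by
      rw [← map_mul, hc b b.2.1 c c.2.1, map_mul]
    exact LinearMap.ext fun v => congrArg (fun S : E →L[ℂ] E => S v) this
  rw [eq_top_iff, ← LinearMap.IsSymmetric.iSup_iInf_eq_top_of_commute hT hcomm]
  refine iSup_le fun χ v hv => Submodule.subset_span fun b hb => ?_
  rw [Submodule.mem_iInf] at hv
  have hv' : ∀ b (hb : b ∈ B ∧ IsSelfAdjoint b), Θ b v = χ ⟨b, hb⟩ • v := fun b hb =>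
    Module.End.mem_eigenspace_iff.1 (hv ⟨b, hb⟩)
  refine ⟨χ ⟨_, realPart_mem hb, (realPart b).2⟩ +
    Complex.I * χ ⟨_, imaginaryPart_mem hb, (imaginaryPart b).2⟩, ?_⟩
  conv_lhs => rw [← realPart_add_I_smul_imaginaryPart b]
  rw [map_add, map_smul, add_apply, smul_apply,
    hv' _ ⟨realPart_mem hb, (realPart b).2⟩, hv' _ ⟨imaginaryPart_mem hb, (imaginaryPart b).2⟩,
    add_smul, mul_smul]

/-- Each vector of a basis of common eigenvectors gives a character of `B`, and its vector state
extends that character. Unique extension and surjectivity of `Θ` make the characters distinct.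
Distinct characters force orthogonality and, by linear independence, let all eigenvalues be
prescribed at once. -/
theorem exists_eigenbasis_of_unique_extension (Θ : A →⋆ₐ[ℂ] (E →L[ℂ] E))
    (hΘ : Function.Surjective Θ) {B : StarSubalgebra ℂ A}
    (hc : ∀ x ∈ B, ∀ y ∈ B, x * y = y * x)
    (huniq : ∀ f : B →ₗ[ℂ] ℂ, IsPureState f →
      ∃! g : A →ₗ[ℂ] ℂ, IsState g ∧ ∀ b : B, g (b : A) = f b) :
    ∃ (κ : Set E) (_ : Fintype κ) (u : Module.Basis κ ℂ E), Orthonormal ℂ u ∧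
      ∀ d : κ → ℂ, ∃ b ∈ B, ∀ k, Θ b (u k) = d k • u k := by
  classical
  obtain ⟨κ, hκ, hspan, hli⟩ := exists_linearIndependent ℂ
    {v : E | ∀ b ∈ B, ∃ c : ℂ, Θ b v = c • v}
  rw [span_common_eigenvectors Θ hc] at hspan
  have : Finite κ := hli.finite
  have hfin : Fintype κ := Fintype.ofFinite κ
  have hn : ∀ k : κ, ‖(k : E)‖ ≠ 0 := fun k => norm_ne_zero_iff.2 (hli.ne_zero k)
  let u₀ : Module.Basis κ ℂ E := Module.Basis.mk hli (by rw [Subtype.range_coe, hspan])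
  let u : Module.Basis κ ℂ E := u₀.isUnitSMul (w := fun k => ((‖(k : E)‖⁻¹ : ℝ) : ℂ))
    fun k => IsUnit.mk0 _ (Complex.ofReal_ne_zero.2 (inv_ne_zero (hn k)))
  have hu : ∀ k, u k = ((‖(k : E)‖⁻¹ : ℝ) : ℂ) • (k : E) := fun k => by
    simp [u, u₀, Module.Basis.isUnitSMul_apply]
  have hu1 : ∀ k, ‖u k‖ = 1 := fun k => by
    rw [hu, norm_smul, Complex.norm_real, norm_inv, norm_norm, inv_mul_cancel₀ (hn k)]
  have hee : ∀ k, inner ℂ (u k) (u k) = 1 := fun k => by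
    rw [inner_self_eq_norm_sq_to_K, hu1]; simp
  have heig : ∀ k, ∀ b ∈ B, Θ b (u k) = vectorState Θ (u k) b • u k := fun k b hb => by
    obtain ⟨c, hc⟩ := hκ k.2 b hb
    have h1 : Θ b (u k) = c • u k := by rw [hu, map_smul, hc, smul_comm]
    rw [vectorState_apply, h1, inner_smul_right, hee, mul_one]
  have hmul : ∀ k, ∀ b ∈ B, ∀ b' ∈ B,
      vectorState Θ (u k) (b * b') = vectorState Θ (u k) b * vectorState Θ (u k) b' :=
    fun k b hb b' hb' => by
      rw [vectorState_apply, map_mul, mul_apply_eq_comp, heig k b' hb', map_smul,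
        inner_smul_right, mul_comm]
      rfl
  let χ : κ → B →* ℂ := fun k =>
    { toFun := fun b => vectorState Θ (u k) b
      map_one' := (isState_vectorState Θ (hu1 k)).2
      map_mul' := fun b b' => hmul k b b.2 b' b'.2 }
  have hχ : Function.Injective χ := fun j k hjk => by
    by_contra hne
    let f : B →ₗ[ℂ] ℂ := vectorState Θ (u j) ∘ₗ B.toSubmodule.subtype
    have hf : IsPureState f := by
      refine isPureState_of_map_mul ⟨fun a => ?_, ?_⟩ fun x y => hmul j x x.2 y y.2
      · exact (isState_vectorState Θ (hu1 j)).1 a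
      · exact (isState_vectorState Θ (hu1 j)).2
    have heq : vectorState Θ (u j) = vectorState Θ (u k) :=
      (huniq f hf).unique ⟨isState_vectorState Θ (hu1 j), fun b => rfl⟩
        ⟨isState_vectorState Θ (hu1 k), fun b => (DFunLike.congr_fun hjk b).symm⟩
    -- The rank-one operator of the component `w` of `u k` orthogonal to `u j` separates the two
    -- vector states unless `w = 0`, which linear independence excludes.
    obtain ⟨w, hw⟩ : ∃ w, w = u k - inner ℂ (u j) (u k) • u j := ⟨_, rfl⟩
    have hwj : inner ℂ w (u j) = 0 := by
      rw [hw, inner_sub_left, inner_smul_left, hee, mul_one, inner_conj_symm, sub_self]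
    have hwk : inner ℂ w (u k) = inner ℂ w w := by
      conv_rhs => rw [hw, inner_sub_right, inner_smul_right, ← hw, hwj, mul_zero, sub_zero]
    obtain ⟨a, ha⟩ := hΘ ((innerSL ℂ w).smulRight w)
    have h1 := LinearMap.congr_fun heq a
    simp only [vectorState_apply, ha, ContinuousLinearMap.smulRight_apply, innerSL_apply_apply,
      inner_smul_right, hwj, zero_mul, hwk] at h1
    rw [← inner_conj_symm (u k) w, hwk] at h1
    have h2 : w = 0 := by
      rcases mul_eq_zero.1 h1.symm with h | h
      · exact inner_self_eq_zero.1 h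
      · exact inner_self_eq_zero.1 ((map_eq_zero _).1 h)
    rw [h2] at hw
    have h3 := congrArg (fun v => u.repr v k) hw
    simp [Ne.symm hne] at h3
  have horth : Orthonormal ℂ u := by
    refine ⟨hu1, fun j k hjk => ?_⟩
    obtain ⟨b, hb⟩ : ∃ b : B, χ j b ≠ χ k b := by
      by_contra! h
      exact hjk (hχ (DFunLike.ext _ _ h))
    have e1 : inner ℂ (u j) (Θ b (u k)) = χ k b * inner ℂ (u j) (u k) := by
      rw [heig k b b.2, inner_smul_right]
      rfl
    have e2 : inner ℂ (u j) (Θ b (u k)) = χ j b * inner ℂ (u j) (u k) := by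
      have h1 : Θ (star (b : A)) = (Θ b).adjoint := by
        rw [map_star, ContinuousLinearMap.star_eq_adjoint]
      rw [← ContinuousLinearMap.adjoint_inner_left, ← h1, heig j _ (star_mem b.2),
        inner_smul_left, vectorState_apply, h1, ContinuousLinearMap.adjoint_inner_right,
        inner_conj_symm]
      rfl
    have h3 := e1.symm.trans e2
    by_contra h0
    exact hb (mul_right_cancel₀ h0 h3).symm
  refine ⟨κ, hfin, u, horth, ?_⟩
  -- Dedekind's independence of characters: a functional vanishing on the range of `F` would be a
  -- linear relation between the `χ k`.
  have hind : LinearIndependent ℂ fun k => (χ k : B → ℂ) :=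
    (linearIndependent_monoidHom B ℂ).comp χ hχ
  let F : B →ₗ[ℂ] (κ → ℂ) := LinearMap.pi fun k =>
    vectorState Θ (u k) ∘ₗ B.toSubmodule.subtype
  have hF : LinearMap.range F = ⊤ := by
    by_contra hne
    obtain ⟨l, hl0, hl⟩ := Submodule.exists_le_ker_of_lt_top _ (lt_top_iff_ne_top.2 hne)
    refine hl0 (LinearMap.pi_ext' fun k => LinearMap.ext_ring ?_)
    have := Fintype.linearIndependent_iff.1 hind (fun k => l (Pi.single k 1)) (by
      funext b
      have h1 : l (F b) = 0 := hl ⟨b, rfl⟩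
      rw [← Finset.univ_sum_single (F b), map_sum] at h1
      rw [Finset.sum_apply, Pi.zero_apply, ← h1]
      refine Finset.sum_congr rfl fun k _ => ?_
      have h2 : (Pi.single k (F b k) : κ → ℂ) = F b k • Pi.single k 1 := by
        rw [← Pi.single_smul, smul_eq_mul, mul_one]
      rw [h2, map_smul, Pi.smul_apply, smul_eq_mul, smul_eq_mul, mul_comm]
      rfl) k
    simpa using this
  intro d
  obtain ⟨b, hb⟩ := LinearMap.range_eq_top.1 hF d
  refine ⟨b, b.2, fun k => ?_⟩
  rw [heig k b b.2]
  exact congrArg (· • u k) (congrFun hb k)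

end Base

/-! ### Homogeneous algebras as matrix fields -/

section Evaluation

open scoped Matrix.Norms.L2Operator

theorem exists_diagonal_of_unique_extension {A : Type u} [CStarAlgebra A] {r : ℕ}
    (ρ : A →⋆ₐ[ℂ] Matrix (Fin r) (Fin r) ℂ) (hρ : Function.Surjective ρ)
    {B : StarSubalgebra ℂ A} (hc : ∀ x ∈ B, ∀ y ∈ B, x * y = y * x)
    (huniq : ∀ f : B →ₗ[ℂ] ℂ, IsPureState f →
      ∃! g : A →ₗ[ℂ] ℂ, IsState g ∧ ∀ b : B, g (b : A) = f b) :
    ∃ (κ : Type) (_ : Fintype κ) (_ : DecidableEq κ)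
      (U : Matrix (Fin r) κ ℂ), U * U.conjTranspose = 1 ∧ U.conjTranspose * U = 1 ∧
      ∀ d : κ → ℂ, ∃ b ∈ B, ρ b = U * Matrix.diagonal d * U.conjTranspose := by
  classical
  let Θ : A →⋆ₐ[ℂ] (EuclideanSpace ℂ (Fin r) →L[ℂ] EuclideanSpace ℂ (Fin r)) :=
    ((Matrix.toEuclideanCLM (n := Fin r) (𝕜 := ℂ) : Matrix (Fin r) (Fin r) ℂ →⋆ₐ[ℂ] _)).comp ρ
  have hΘ : Function.Surjective Θ := (Matrix.toEuclideanCLM (n := Fin r) (𝕜 := ℂ)).surjective.comp hρ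
  obtain ⟨κ, _, u, hu, hd⟩ := exists_eigenbasis_of_unique_extension Θ hΘ hc huniq
  let U : Matrix (Fin r) κ ℂ := Matrix.of fun i k => u k i
  have hU' : U.conjTranspose * U = 1 := by
    ext j k
    have h := orthonormal_iff_ite.1 hu j k
    rw [EuclideanSpace.inner_eq_star_dotProduct] at h
    rw [Matrix.one_apply, ← h, Matrix.mul_apply, dotProduct]
    exact Finset.sum_congr rfl fun i _ => mul_comm _ _
  have hU : U * U.conjTranspose = 1 := by
    refine (Matrix.mul_eq_one_comm_of_card_eq (Fin r) κ ℂ ?_).2 hU'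
    rw [← Module.finrank_eq_card_basis u, finrank_euclideanSpace]
  refine ⟨κ, inferInstance, inferInstance, U, hU, hU', fun d => ?_⟩
  obtain ⟨b, hb, h⟩ := hd d
  refine ⟨b, hb, ?_⟩
  have h1 : ρ b * U = U * Matrix.diagonal d := by
    ext i k
    have := congrArg (fun v : EuclideanSpace ℂ (Fin r) => v i) (h k)
    rw [Matrix.mul_diagonal, Matrix.mul_apply]
    refine (Eq.trans ?_ this).trans (mul_comm _ _)
    rfl
  rw [← h1, Matrix.mul_assoc, hU, Matrix.mul_one]

namespace MatrixBundle

variable (E : MatrixBundle.{u, v})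

theorem exists_coord_eq (x : E.Z) :
    ∃ α : E.Fib x ≃⋆ₐ[ℂ] E.Mat, ∀ v, E.coord x v = α v :=
  E.triv_star _ (FiberBundle.trivialization_mem_atlas' x) x
    (FiberBundle.mem_baseSet_trivializationAt' x)

variable {E}

theorem IsContSection.ofReal_smul_one {h : E.Z → ℝ} (hh : Continuous h) :
    E.IsContSection fun x => (h x : ℂ) • (1 : E.Fib x) := by
  rw [isContSection_iff]
  intro x₀
  have hc : ContinuousAt (fun x => (h x : ℂ) • (1 : E.Mat)) x₀ :=
    ((Complex.continuous_ofReal.comp hh).smul continuous_const).continuousAt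
  refine hc.congr ?_
  filter_upwards [E.eventually_loc x₀] with x ⟨α, hα⟩
  rw [hα, map_smul, map_one]

/-- Every element of a fibre is the value of a continuous section. -/
theorem exists_section_apply_eq (x₀ : E.Z) (v : E.Fib x₀) : ∃ s : E.Sections, s x₀ = v := by
  classical
  let e := trivializationAt E.Mat E.Fib x₀
  have hx₀ : x₀ ∈ e.baseSet := FiberBundle.mem_baseSet_trivializationAt' x₀
  choose α hα using fun x (hx : x ∈ e.baseSet) =>
    E.triv_star e (FiberBundle.trivialization_mem_atlas' x₀) x hx
  -- The cutoff `h` vanishes off the closed set `K` inside the base set, so the locally constant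
  -- section times `h` extends continuously by zero.
  obtain ⟨K, hK, hKc, hKsub⟩ := exists_mem_nhds_isClosed_subset (e.open_baseSet.mem_nhds hx₀)
  obtain ⟨h, h0, h1, -⟩ := exists_continuous_zero_one_of_isClosed
    (s := (interior K)ᶜ) (t := {x₀}) isOpen_interior.isClosed_compl isClosed_singleton (by
      rw [Set.disjoint_singleton_right]
      exact fun h => h (mem_interior_iff_mem_nhds.2 hK))
  let s : ∀ x, E.Fib x := fun x =>
    if hx : x ∈ e.baseSet then (h x : ℂ) • (α x hx).symm (α x₀ hx₀ v) else 0
  have hs : E.IsContSection s := by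
    rw [IsContSection, continuous_iff_continuousAt]
    intro x
    by_cases hx : x ∈ e.baseSet
    · have ht : (x, (h x : ℂ) • α x₀ hx₀ v) ∈ e.toOpenPartialHomeomorph.symm.source := by
        rw [OpenPartialHomeomorph.symm_source, e.mem_target]
        exact hx
      have hc : ContinuousAt (fun y => (y, (h y : ℂ) • α x₀ hx₀ v)) x :=
        (continuous_id.prodMk ((Complex.continuous_ofReal.comp h.continuous).smul
          continuous_const)).continuousAt
      refine (ContinuousAt.comp (f := fun y => (y, (h y : ℂ) • α x₀ hx₀ v))
        (e.toOpenPartialHomeomorph.symm.continuousAt ht) hc).congr ?_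
      filter_upwards [e.open_baseSet.mem_nhds hx] with y hy
      have he : e (TotalSpace.mk' E.Mat y (s y)) = (y, (h y : ℂ) • α x₀ hx₀ v) := by
        refine Prod.ext (e.coe_fst' hy) ?_
        refine (hα y hy (s y)).trans ?_
        simp only [s, dif_pos hy, map_smul]
        exact congrArg _ ((α y hy).apply_symm_apply _)
      rw [Function.comp_apply, ← he]
      exact e.symm_apply_apply (e.mem_source.2 hy)
    · have hz : E.IsContSection 0 := E.sectionSubalgebra.zero_mem
      refine (hz.continuousAt (x := x)).congr ?_
      have hxK : x ∉ K := fun hxK => hx (hKsub hxK)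
      filter_upwards [hKc.isOpen_compl.mem_nhds hxK] with y hy
      have hhy : h y = 0 := h0 fun hyK => hy (interior_subset hyK)
      simp [s, hhy]
  refine ⟨⟨s, hs⟩, ?_⟩
  change s x₀ = v
  have hh : h x₀ = 1 := h1 rfl
  simp [s, hx₀, hh]

end MatrixBundle

namespace HomogeneousAlgebra

variable {ι : Type w} (E : ι → MatrixBundle.{u, v})

/-- Evaluation at a point of the base as a *-homomorphism. -/
def evHom [Fintype ι] (x : Base E) :
    HomogeneousAlgebra E →⋆ₐ[ℂ] Matrix (Fin (rank E x)) (Fin (rank E x)) ℂ where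
  toFun := ev E x
  map_one' := by
    obtain ⟨α, hα⟩ := (E x.1).exists_coord_eq x.2
    exact (hα _).trans (map_one α)
  map_mul' a b := by
    obtain ⟨α, hα⟩ := (E x.1).exists_coord_eq x.2
    simp only [ev, hα]
    exact map_mul α _ _
  map_zero' := by
    obtain ⟨α, hα⟩ := (E x.1).exists_coord_eq x.2
    exact (hα _).trans (map_zero α)
  map_add' a b := by
    obtain ⟨α, hα⟩ := (E x.1).exists_coord_eq x.2
    simp only [ev, hα]
    exact map_add α _ _
  commutes' c := by
    obtain ⟨α, hα⟩ := (E x.1).exists_coord_eq x.2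
    exact (hα _).trans (AlgHomClass.commutes α c)
  map_star' a := by
    obtain ⟨α, hα⟩ := (E x.1).exists_coord_eq x.2
    simp only [ev, hα]
    exact map_star α _

variable [Fintype ι]

theorem exists_evHom_eq (x : Base E) : ∃ α : (E x.1).Fib x.2 ≃⋆ₐ[ℂ] (E x.1).Mat,
    ∀ a, evHom E x a = α (a x.1 x.2) := by
  obtain ⟨α, hα⟩ := (E x.1).exists_coord_eq x.2
  exact ⟨α, fun a => hα _⟩

theorem evHom_surjective (x : Base E) : Function.Surjective (evHom E x) := by
  classical
  intro M
  obtain ⟨α, hα⟩ := exists_evHom_eq E x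
  obtain ⟨s, hs⟩ := MatrixBundle.exists_section_apply_eq x.2 (α.symm M)
  refine ⟨Pi.single x.1 s, ?_⟩
  rw [hα, Pi.single_eq_same, hs]
  exact α.apply_symm_apply M

theorem isMatrixField : IsMatrixField (evHom E) where
  ext a b h := by
    funext i
    refine MatrixBundle.Sections.ext fun z => ?_
    obtain ⟨α, hα⟩ := exists_evHom_eq E ⟨i, z⟩
    have := h ⟨i, z⟩
    rw [hα, hα] at this
    exact α.injective this
  continuous_norm a := by
    refine continuous_sigma fun i => ?_
    refine (MatrixBundle.Sections.continuous_norm_apply (a i)).congr fun z => ?_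
    obtain ⟨α, hα⟩ := exists_evHom_eq E ⟨i, z⟩
    rw [hα]
    exact (NonUnitalStarAlgHom.norm_map α α.injective _).symm
  exists_central h := by
    refine ⟨fun i => ⟨fun z => (h ⟨i, z⟩ : ℂ) • 1,
      MatrixBundle.IsContSection.ofReal_smul_one (h.continuous.comp continuous_sigmaMk)⟩,
      fun x => ?_⟩
    obtain ⟨α, hα⟩ := exists_evHom_eq E x
    exact (hα _).trans ((map_smul α _ _).trans (congrArg _ (map_one α)))
  eventually_rank x₀ := by
    obtain ⟨i, z⟩ := x₀
    rw [Sigma.nhds_mk, eventually_map]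
    exact Eventually.of_forall fun _ => rfl

variable {E} in
theorem isFieldDiagonal_of_isCStarDiagonal {B : StarSubalgebra ℂ (HomogeneousAlgebra E)}
    (hB : IsCStarDiagonal B) : IsFieldDiagonal (evHom E) B where
  mem_iff := hB.mem_iff_commute
  exists_diagonal x := exists_diagonal_of_unique_extension (evHom E x) (evHom_surjective E x)
    hB.maximal_abelian.prop hB.unique_extension

end HomogeneousAlgebra

end Evaluation

end

/-! ### The main theorem -/

theorem corollary3p4
    (ι : ℕ → Type w) [∀ n, Fintype (ι n)] (E : ∀ n, ι n → MatrixBundle.{u, v})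
    (φ : ∀ n, HomogeneousAlgebra (E n) →⋆ₐ[ℂ] HomogeneousAlgebra (E (n + 1)))
    (hinj : ∀ n, Function.Injective (φ n))
    (hmax : ∀ n, HomogeneousAlgebra.IsMaximallyHomogeneous (φ n))
    (hdiag : ∃ B : StarSubalgebra ℂ (HomogeneousAlgebra (E 0)), IsCStarDiagonal B)
    (A : Type*) [CStarAlgebra A] (ψ : ∀ n, HomogeneousAlgebra (E n) →⋆ₐ[ℂ] A)
    (hA : IsInductiveLimit φ A ψ) :
    ∃ B : StarSubalgebra ℂ A, IsCStarDiagonal B := by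
  obtain ⟨B₀, hB₀⟩ := hdiag
  -- The commutant is used rather than the image because it contains the centre of the next algebra,
  -- which the image need not.
  let B : ∀ n, StarSubalgebra ℂ (HomogeneousAlgebra (E n)) := fun n =>
    Nat.rec B₀ (fun n B => StarSubalgebra.centralizer ℂ (φ n '' B)) n
  have hfield := fun n => HomogeneousAlgebra.isMatrixField (E n)
  have hφ : ∀ n, IsMultiplicityFree (HomogeneousAlgebra.evHom (E n))
      (HomogeneousAlgebra.evHom (E (n + 1))) (φ n) := fun n => hmax n
  have hB : ∀ n, IsFieldDiagonal (HomogeneousAlgebra.evHom (E n)) (B n) := fun n => by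
    induction n with
    | zero => exact HomogeneousAlgebra.isFieldDiagonal_of_isCStarDiagonal hB₀
    | succ n ih => exact ih.centralizer (hfield n) (hfield (n + 1)) (hφ n)
  exact hA.exists_isCStarDiagonal hinj (B := B)
    (fun n b hb => (hB n).map_mem_centralizer (φ n) hb)
    (fun n => (hB n).exists_isDiagonalPair (hfield n))
    fun n a ha => (hB n).map_mem_normalizers (hfield n) (hfield (n + 1)) (hφ n) ha
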